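/- Let $X_1,X_2,\dots$ be independent, identically distributed random vectors in $\mathbb{R}^d$. Suppose there are linear operators $B_n$ on $\mathbb{R}^d$, vectors $b_n\in\mathbb{R}^d$ and non-negative integers $k_n\to\infty$ with $k_{n+1}/k_n\to 1$ (for instance $k_n=n$) such that $$B_n(X_1+\dots+X_{k_n})-b_n\longrightarrow Y\quad\text{in distribution},$$ where $Y$ has a probability density $\varpi:\mathbb{R}^d\to[0,\infty)$ with $\varpi(-x)=\varpi(x)$ for all $x$. For a positive rational $r=p/q$ ($p,q$ positive integers), a density $g$ is called an $r$-fold auto-convolution of $\varpi$ if there is a probability density $h$ whose $q$-fold auto-convolution is $\varpi$ and whose $p$-fold auto-convolution is $g$ (as measures, i.e. almost everywhere). For real $t>0$, a probability density $g$ is the $t$-th auto-convolution $\varpi^{t\otimes}$ of $\varpi$ if $r$-fold auto-convolutions of $\varpi$ exist for all positive rationals $r$ and if, for all positive rationals $t_n\to t$ and all choices of $t_n$-fold auto-convolutions $g_n$ of $\varpi$, one has $g_n\to g$ in $L^1(\mathbb{R}^d)$. For a real $d\times d$ matrix $A$ put $t^{A}=\exp((\log t)A)$. Then there is a real $d\times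 d$ matrix $E$ such that for every $t>0$ the density $\varpi^{t\otimes}$ exists, and $$\varpi^{t\otimes}(x)=\det\left(t^{-E}\right)\,\varpi\left(t^{-E}x\right)$$ for almost every $x\in\mathbb{R}^d$. If moreover $\varpi$ is continuous, then $\varpi^{t\otimes}$ has a continuous version, and for this version the equation holds for every $x\in\mathbb{R}^d$ (in particular for every $x\neq 0$). -/

import Mathlib

open MeasureTheory ProbabilityTheory Filter Topology

/-- `f` is a probability density function on `ℝ^d` (with respect to Lebesgue measure). -/
structure IsProbDensity {d : ℕ} (f : EuclideanSpace ℝ (Fin d) → ℝ) : Prop where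
  nonneg : ∀ x, 0 ≤ f x
  integrable : Integrable f
  integral_eq_one : ∫ x, f x = 1

/-- The measure `f(x) dx` on `ℝ^d`. -/
noncomputable def densityMeasure {d : ℕ} (f : EuclideanSpace ℝ (Fin d) → ℝ) :
    Measure (EuclideanSpace ℝ (Fin d)) :=
  volume.withDensity (fun x => ENNReal.ofReal (f x))

/-- The `n`-fold auto-convolution `μ ∗ ⋯ ∗ μ` of a measure on `ℝ^d`. -/
noncomputable def autoConv {d : ℕ} (μ : Measure (EuclideanSpace ℝ (Fin d))) :
    ℕ → Measure (EuclideanSpace ℝ (Fin d))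
  | 0 => Measure.dirac 0
  | n + 1 => Measure.conv (autoConv μ n) μ

/-- The density `g` is an `r`-fold auto-convolution of the density `f`, for a positive rational
`r = p / q`: there is a density `h` whose `q`-fold auto-convolution is `f` and whose
`p`-fold auto-convolution is `g`. -/
def IsRatConvPower {d : ℕ} (f : EuclideanSpace ℝ (Fin d) → ℝ) (r : ℚ)
    (g : EuclideanSpace ℝ (Fin d) → ℝ) : Prop :=
  IsProbDensity g ∧ ∃ p q : ℕ, 0 < p ∧ 0 < q ∧ r = (p : ℚ) / (q : ℚ) ∧
    ∃ h : EuclideanSpace ℝ (Fin d) → ℝ, IsProbDensity h ∧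
      autoConv (densityMeasure h) q = densityMeasure f ∧
      autoConv (densityMeasure h) p = densityMeasure g

/-- The density `g` is the `t`-th auto-convolution of the density `f`, for a real `t > 0`: all
positive rational auto-convolutions of `f` exist, and `g` is the limit in `L¹` of the `r n`-fold
auto-convolutions of `f` for every sequence of positive rationals `r n → t` (whatever the
choice of these auto-convolutions). -/
structure IsConvPower {d : ℕ} (f : EuclideanSpace ℝ (Fin d) → ℝ) (t : ℝ)
    (g : EuclideanSpace ℝ (Fin d) → ℝ) : Prop where
  isProbDensity : IsProbDensity g
  exists_rat : ∀ r : ℚ, 0 < r → ∃ h, IsRatConvPower f r h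
  tendsto : ∀ (r : ℕ → ℚ) (h : ℕ → EuclideanSpace ℝ (Fin d) → ℝ),
    (∀ n, 0 < r n) → Tendsto (fun n => (r n : ℝ)) atTop (𝓝 t) →
    (∀ n, IsRatConvPower f (r n) (h n)) →
    Tendsto (fun n => ∫ x, |h n x - g x|) atTop (𝓝 0)

/-- The matrix power `t^A = exp((log t) A)` of a real number `t > 0`. -/
noncomputable def rpowMatrix {d : ℕ} (t : ℝ) (A : Matrix (Fin d) (Fin d) ℝ) :
    Matrix (Fin d) (Fin d) ℝ :=
  NormedSpace.exp (Real.log t • A)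

/-- The function `x ↦ det(t^{-E}) f(t^{-E} x)`. -/
noncomputable def scaledDensity {d : ℕ} (E : Matrix (Fin d) (Fin d) ℝ) (t : ℝ)
    (f : EuclideanSpace ℝ (Fin d) → ℝ) (x : EuclideanSpace ℝ (Fin d)) : ℝ :=
  (rpowMatrix t (-E)).det * f (Matrix.toEuclideanCLM (𝕜 := ℝ) (rpowMatrix t (-E)) x)

/-!
The limit law of normed sums of independent identically distributed vectors is operator-stable, and
for an even density this shows in the characteristic function `a` of `ϖ`: it is real and positive,
and there are operators `A` with `a (t ^ A u) = a u ^ t` for all `t > 0`. Then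
`det (t ^ (-E)) ϖ (t ^ (-E) x)`, with `E` the transpose of `A`, is a density with characteristic
function `a ^ t`, and this identifies it with the auto-convolution of order `t`.

Only moduli of characteristic functions enter, so the centring vectors `b n` drop out. With `f` the
modulus of the characteristic function of a summand and `T n` the adjoint of `B n`, the hypothesis
says that `f (T n u) ^ k n → a u`, locally uniformly in `u` (`tendsto_charFun_prod_nhds`).

* The limit `a` does not vanish anywhere (`ne_zero_of_tendsto_pow`), because
  `1 - ‖φ (2 u)‖² ≤ 4 (1 - ‖φ u‖²)` for characteristic functions `φ`. By the Riemann–Lebesgue lemma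
  it is not identically `1` on any line.
* If `k (l n) / k n → exp s`, then `f (T n u) ^ k (l n) → a u ^ exp s`. Comparing this with
  `f (T (l n) u) ^ k (l n) → a u`, a convergence of types argument
  (`exists_tendsto_of_tendsto_comp`) yields a limit point `C` of the operators
  `(T (l n))⁻¹ T n`, and `a (C u) = a u ^ exp s` (`scalingOperators_nonempty`).
* The pairs `(s, C)` with `a ∘ C = a ^ exp s` form a closed group that projects onto `ℝ` with
  compact fibres. Such a group contains a one-parameter subgroup `s ↦ (s, exp (s A))`
  (`IsProperGradedGroup.exists_exp_mem`).
* A law with positive characteristic function has only one convolution root of each order, since two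
  roots differ by a continuous function with values in the roots of unity
  (`IsRatConvPower.ae_eq`). The action of linear automorphisms on `L¹` is continuous
  (`tendsto_integral_abs_sub_comp_clequiv`), which passes from rational to real orders.
-/

/-! ### One-parameter subgroups of a closed graded group of operators -/

section OneParameter

variable {𝔸 : Type*} [NormedRing 𝔸]

theorem norm_pow_sub_pow_le [NormOneClass 𝔸] {a b : 𝔸} {M : ℝ} (hM : 1 ≤ M) (ha : ‖a‖ ≤ M)
    (hb : ‖b‖ ≤ M) (n : ℕ) : ‖a ^ n - b ^ n‖ ≤ n * ‖a - b‖ * M ^ n := by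
  induction n with
  | zero => simp
  | succ n ih =>
    have h : a ^ (n + 1) - b ^ (n + 1) = (a ^ n - b ^ n) * a + b ^ n * (a - b) := by
      rw [pow_succ, pow_succ]; noncomm_ring
    have hMn : 0 ≤ M ^ n := by positivity
    calc ‖a ^ (n + 1) - b ^ (n + 1)‖
        ≤ ‖a ^ n - b ^ n‖ * ‖a‖ + ‖b ^ n‖ * ‖a - b‖ := by
          rw [h]
          exact (norm_add_le _ _).trans (add_le_add (norm_mul_le _ _) (norm_mul_le _ _))
      _ ≤ (n * ‖a - b‖ * M ^ n) * M + M ^ n * ‖a - b‖ := by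
          gcongr
          exact (norm_pow_le b n).trans (by gcongr)
      _ ≤ (n * ‖a - b‖ * M ^ n) * M + M ^ n * ‖a - b‖ * M := by
          have := mul_nonneg hMn (norm_nonneg (a - b))
          nlinarith
      _ = ((n + 1 : ℕ) : ℝ) * ‖a - b‖ * M ^ (n + 1) := by push_cast; ring

/-- A family of subsets `Γ s` (`s : ℝ`) of an algebra that behaves like the fibres of a closed
group of pairs `(s, A)` projecting properly onto `ℝ`. Properness is stated with ultrafilters: a
family `A i ∈ Γ (s i)` with `s i → σ` along an ultrafilter converges to an element of `Γ σ`. -/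
structure IsProperGradedGroup (Γ : ℝ → Set 𝔸) : Prop where
  nonempty : ∀ s, (Γ s).Nonempty
  mul_mem : ∀ {s s' : ℝ} {A A' : 𝔸}, A ∈ Γ s → A' ∈ Γ s' → A * A' ∈ Γ (s + s')
  exists_inv : ∀ {s : ℝ} {A : 𝔸}, A ∈ Γ s → ∃ A' ∈ Γ (-s), A * A' = 1
  exists_lim : ∀ (U : Ultrafilter ℕ) {s : ℕ → ℝ} {A : ℕ → 𝔸} {σ : ℝ}, (∀ᶠ n in U, A n ∈ Γ (s n)) →
    Tendsto s U (𝓝 σ) → ∃ A' ∈ Γ σ, Tendsto A U (𝓝 A')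

variable {Γ : ℝ → Set 𝔸}

namespace IsProperGradedGroup

theorem mem_of_tendsto (hΓ : IsProperGradedGroup Γ) (U : Ultrafilter ℕ) {s : ℕ → ℝ} {A : ℕ → 𝔸}
    {σ : ℝ} {A' : 𝔸} (hA : ∀ᶠ n in U, A n ∈ Γ (s n)) (hs : Tendsto s U (𝓝 σ))
    (hA' : Tendsto A U (𝓝 A')) : A' ∈ Γ σ := by
  obtain ⟨C, hC, hAC⟩ := hΓ.exists_lim U hA hs
  rwa [tendsto_nhds_unique hA' hAC]

theorem one_mem (hΓ : IsProperGradedGroup Γ) : (1 : 𝔸) ∈ Γ 0 := by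
  obtain ⟨A, hA⟩ := hΓ.nonempty 0
  obtain ⟨A', hA', h⟩ := hΓ.exists_inv hA
  simpa [h] using hΓ.mul_mem hA hA'

theorem pow_mem (hΓ : IsProperGradedGroup Γ) {s : ℝ} {A : 𝔸} (hA : A ∈ Γ s) (n : ℕ) :
    A ^ n ∈ Γ (n * s) := by
  induction n with
  | zero => simpa using hΓ.one_mem
  | succ n ih =>
    have := hΓ.mul_mem ih hA
    rw [pow_succ]
    convert this using 1
    push_cast; ring_nf

theorem isClosed (hΓ : IsProperGradedGroup Γ) (s : ℝ) : IsClosed (Γ s) := by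
  refine isClosed_of_closure_subset fun A hA => ?_
  obtain ⟨x, hx, hxA⟩ := mem_closure_iff_seq_limit.1 hA
  exact hΓ.mem_of_tendsto (hyperfilter ℕ) (Eventually.of_forall hx) tendsto_const_nhds
    (hxA.mono_left Nat.hyperfilter_le_atTop)

end IsProperGradedGroup

variable [NormedAlgebra ℝ 𝔸]

theorem norm_exp_le_exp_norm [NormOneClass 𝔸] [CompleteSpace 𝔸] (a : 𝔸) :
    ‖NormedSpace.exp a‖ ≤ Real.exp ‖a‖ := by
  have hs := NormedSpace.norm_expSeries_summable' (𝕂 := ℝ) a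
  rw [NormedSpace.exp_eq_tsum ℝ, Real.exp_eq_exp_ℝ, NormedSpace.exp_eq_tsum ℝ]
  refine (norm_tsum_le_tsum_norm hs).trans (hs.tsum_le_tsum (fun n => ?_)
    (NormedSpace.expSeries_summable' (𝕂 := ℝ) ‖a‖))
  rw [norm_smul, smul_eq_mul, norm_inv, RCLike.norm_natCast]
  gcongr
  exact norm_pow_le a n

/-- Compound interest in a Banach algebra: if `(A i - 1) / w i → E` and `m i * w i → τ` with
`w i → 0+`, then `A i ^ m i → exp (τ E)`. -/
theorem tendsto_pow_exp [NormOneClass 𝔸] [CompleteSpace 𝔸] {ι : Type*} {l : Filter ι}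
    {A : ι → 𝔸} {w : ι → ℝ} {m : ι → ℕ} {E : 𝔸} {τ : ℝ}
    (hw : ∀ᶠ i in l, 0 < w i) (hw0 : Tendsto w l (𝓝 0))
    (hA : Tendsto (fun i => (w i)⁻¹ • (A i - 1)) l (𝓝 E))
    (hm : Tendsto (fun i => m i * w i) l (𝓝 τ)) :
    Tendsto (fun i => A i ^ m i) l (𝓝 (NormedSpace.exp (τ • E))) := by
  let : NormedAlgebra ℚ 𝔸 := .restrictScalars ℚ ℝ 𝔸
  have hcont : Continuous fun r : ℝ => NormedSpace.exp (r • E) :=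
    NormedSpace.exp_continuous.comp (continuous_id.smul continuous_const)
  have hpow : ∀ i, NormedSpace.exp (w i • E) ^ m i = NormedSpace.exp ((m i * w i) • E) := by
    intro i
    rw [mul_smul, Nat.cast_smul_eq_nsmul, NormedSpace.exp_nsmul]
  have hB : Tendsto (fun i => NormedSpace.exp (w i • E) ^ m i) l
      (𝓝 (NormedSpace.exp (τ • E))) := by
    simp_rw [hpow]
    exact (hcont.tendsto τ).comp hm
  have hderiv : Tendsto (fun i => (w i)⁻¹ • (NormedSpace.exp (w i • E) - 1)) l (𝓝 E) := by
    have h := hasDerivAt_exp_smul_const (𝕂 := ℝ) E (0 : ℝ)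
    rw [hasDerivAt_iff_tendsto_slope_zero] at h
    simp only [zero_add, zero_smul, NormedSpace.exp_zero, one_mul] at h
    exact h.comp (tendsto_nhdsWithin_iff.2 ⟨hw0, hw.mono fun i hi => hi.ne'⟩)
  have hdiff : Tendsto (fun i => ‖(w i)⁻¹ • (A i - NormedSpace.exp (w i • E))‖) l (𝓝 0) := by
    have := (hA.sub hderiv).norm
    simp only [sub_self, norm_zero] at this
    refine this.congr fun i => ?_
    rw [← smul_sub]; congr 2; abel
  set K : ℝ := ‖E‖ + 1
  have hK : ‖E‖ ≤ K := by simp [K]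
  have hKb : ∀ᶠ i in l, ‖(w i)⁻¹ • (A i - 1)‖ ≤ K :=
    (hA.norm.eventually (ge_mem_nhds (show ‖E‖ < K by simp [K])))
  have hbound : ∀ᶠ i in l, ‖A i ^ m i - NormedSpace.exp (w i • E) ^ m i‖ ≤
      (m i * w i) * ‖(w i)⁻¹ • (A i - NormedSpace.exp (w i • E))‖ *
        Real.exp ((m i * w i) * K) := by
    filter_upwards [hw, hKb] with i hi hKi
    have hAi : ‖A i‖ ≤ Real.exp (w i * K) := by
      have h1 : A i = w i • ((w i)⁻¹ • (A i - 1)) + 1 := by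
        rw [smul_smul, mul_inv_cancel₀ hi.ne', one_smul, sub_add_cancel]
      calc ‖A i‖ ≤ w i * K + 1 := by
            rw [h1]
            refine (norm_add_le _ _).trans ?_
            rw [norm_smul, norm_one, Real.norm_of_nonneg hi.le]
            gcongr
        _ ≤ _ := Real.add_one_le_exp _
    have hEi : ‖NormedSpace.exp (w i • E)‖ ≤ Real.exp (w i * K) := by
      refine (norm_exp_le_exp_norm _).trans (Real.exp_le_exp.2 ?_)
      rw [norm_smul, Real.norm_of_nonneg hi.le]
      gcongr
    refine (norm_pow_sub_pow_le (Real.one_le_exp ?_) hAi hEi (m i)).trans_eq ?_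
    · have := norm_nonneg E
      positivity
    · rw [norm_smul, norm_inv, Real.norm_of_nonneg hi.le, ← Real.exp_nat_mul]
      field_simp
  have hz : Tendsto (fun i => A i ^ m i - NormedSpace.exp (w i • E) ^ m i) l (𝓝 0) := by
    refine squeeze_zero_norm' hbound ?_
    have := (hm.mul hdiff).mul ((Real.continuous_exp.tendsto _).comp (hm.mul_const K))
    simpa using this
  simpa using hz.add hB

namespace IsProperGradedGroup

/-- The exponential of a tangent direction at the identity stays in the group. -/
theorem exp_mem_of_tangent [NormOneClass 𝔸] [CompleteSpace 𝔸] (hΓ : IsProperGradedGroup Γ)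
    (U : Ultrafilter ℕ) {s w : ℕ → ℝ} {A : ℕ → 𝔸} {E : 𝔸} {σ : ℝ}
    (hA : ∀ᶠ n in U, A n ∈ Γ (s n)) (hw : ∀ᶠ n in U, 0 < w n) (hw0 : Tendsto w U (𝓝 0))
    (hE : Tendsto (fun n => (w n)⁻¹ • (A n - 1)) U (𝓝 E))
    (hσ : Tendsto (fun n => s n / w n) U (𝓝 σ)) (τ : ℝ) :
    NormedSpace.exp (τ • E) ∈ Γ (τ * σ) := by
  let : NormedAlgebra ℚ 𝔸 := .restrictScalars ℚ ℝ 𝔸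
  have key : ∀ τ : ℝ, 0 ≤ τ → NormedSpace.exp (τ • E) ∈ Γ (τ * σ) := by
    intro τ hτ
    have hm : Tendsto (fun n => (⌊τ / w n⌋₊ : ℝ) * w n) U (𝓝 τ) := by
      have h1 : Tendsto (fun n => τ - w n) U (𝓝 τ) := by simpa using hw0.const_sub τ
      refine tendsto_of_tendsto_of_tendsto_of_le_of_le' h1 tendsto_const_nhds ?_ ?_
      · filter_upwards [hw] with n hn
        have := (Nat.lt_floor_add_one (τ / w n)).le
        rw [div_le_iff₀ hn] at this
        linarith
      · filter_upwards [hw] with n hn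
        have := Nat.floor_le (div_nonneg hτ hn.le)
        rwa [le_div_iff₀ hn] at this
    refine hΓ.mem_of_tendsto U (hA.mono fun n hn => hΓ.pow_mem hn ⌊τ / w n⌋₊) ?_
      (tendsto_pow_exp hw hw0 hE hm)
    refine (hm.mul hσ).congr' ?_
    filter_upwards [hw] with n hn
    field_simp
  rcases le_total 0 τ with hτ | hτ
  · exact key τ hτ
  · obtain ⟨A', hA', h⟩ := hΓ.exists_inv (key (-τ) (by linarith))
    have : A' = NormedSpace.exp (τ • E) := by
      have h2 : NormedSpace.exp (τ • E) * NormedSpace.exp ((-τ) • E) = 1 := by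
        rw [← NormedSpace.exp_add_of_commute]
        · simp
        · exact (Commute.refl E).smul_left τ |>.smul_right (-τ)
      calc A' = NormedSpace.exp (τ • E) * NormedSpace.exp ((-τ) • E) * A' := by rw [h2, one_mul]
        _ = _ := by rw [mul_assoc, h, mul_one]
    rw [← this]
    convert hA' using 2
    ring

/-- A closed graded group that projects properly onto `ℝ` contains a one-parameter subgroup
which is a section of the projection. Elements `A n ∈ Γ (s n)`, `s n → 0+`, closest to the
identity cannot leave the identity faster than `s n` does: otherwise they would leave it in a
direction `E` tangent to `Γ 0`, and multiplication by `exp (-‖A n - 1‖ E) ∈ Γ 0` would bring them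
closer. Hence `(A n - 1) / s n` has a limit point, which generates the subgroup. -/
theorem exists_exp_mem [NormOneClass 𝔸] [FiniteDimensional ℝ 𝔸] (hΓ : IsProperGradedGroup Γ) :
    ∃ E : 𝔸, ∀ s : ℝ, NormedSpace.exp (s • E) ∈ Γ s := by
  let : NormedAlgebra ℚ 𝔸 := .restrictScalars ℚ ℝ 𝔸
  have : CompleteSpace 𝔸 := FiniteDimensional.complete ℝ 𝔸
  have : ProperSpace 𝔸 := FiniteDimensional.proper ℝ 𝔸
  set U : Ultrafilter ℕ := hyperfilter ℕ
  have hU : (U : Filter ℕ) ≤ atTop := Nat.hyperfilter_le_atTop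
  set s : ℕ → ℝ := fun n => 1 / ((n : ℝ) + 1)
  have hs : ∀ n, 0 < s n := fun n => by positivity
  have hs0 : Tendsto s U (𝓝 0) := tendsto_one_div_add_atTop_nhds_zero_nat.mono_left hU
  -- an element of `Γ (s n)` closest to the identity
  have hmin : ∀ n, ∃ A ∈ Γ (s n), ∀ A' ∈ Γ (s n), ‖A - 1‖ ≤ ‖A' - 1‖ := by
    intro n
    obtain ⟨A, hA, h⟩ := (hΓ.isClosed (s n)).exists_infDist_eq_dist (hΓ.nonempty _) (1 : 𝔸)
    refine ⟨A, hA, fun A' hA' => ?_⟩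
    rw [← dist_eq_norm, ← dist_eq_norm, dist_comm, ← h, dist_comm]
    exact Metric.infDist_le_dist_of_mem hA'
  choose A hA hAmin using hmin
  set δ : ℕ → ℝ := fun n => ‖A n - 1‖
  -- some elements of `Γ (s n)` tend to some `A₀ ∈ Γ 0`; translated by the inverse of `A₀` they tend to
  -- the identity
  have hδ0 : Tendsto δ U (𝓝 0) := by
    obtain ⟨A₀, hA₀, hlim⟩ := hΓ.exists_lim U (Eventually.of_forall hA) hs0
    obtain ⟨C, hC, hAC⟩ := hΓ.exists_inv hA₀
    have h1 : Tendsto (fun n => ‖A n * C - 1‖) U (𝓝 0) := by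
      have := ((hlim.mul_const C).sub_const 1).norm
      simpa [hAC] using this
    refine squeeze_zero (fun n => norm_nonneg _) (fun n => hAmin n _ ?_) h1
    simpa using hΓ.mul_mem (hA n) hC
  have hball : ∀ (f : ℕ → 𝔸) (R : ℝ), (∀ᶠ n in U, ‖f n‖ ≤ R) → ∃ E, Tendsto f U (𝓝 E) := by
    intro f R hf
    obtain ⟨E, -, hE⟩ := (isCompact_closedBall (0 : 𝔸) R).ultrafilter_le_nhds' (U.map f)
      (show ∀ᶠ n in U, f n ∈ Metric.closedBall 0 R from hf.mono fun n hn => by simpa using hn)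
    exact ⟨E, hE⟩
  by_cases hc : ∃ C : ℝ, ∀ᶠ n in U, δ n / s n ≤ C
  -- at most linear speed: `(A n - 1) / s n` converges to a tangent vector that projects to `1`
  · obtain ⟨C, hC⟩ := hc
    obtain ⟨E, hE⟩ := hball (fun n => (s n)⁻¹ • (A n - 1)) C (hC.mono fun n hn => by
      rwa [norm_smul, norm_inv, Real.norm_of_nonneg (hs n).le, inv_mul_eq_div])
    refine ⟨E, fun τ => ?_⟩
    have h1 : Tendsto (fun n => s n / s n) U (𝓝 1) :=
      tendsto_const_nhds.congr fun n => (div_self (hs n).ne').symm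
    simpa using hΓ.exp_mem_of_tangent U (Eventually.of_forall hA) (Eventually.of_forall hs) hs0
      hE h1 τ
  · exfalso
    have hc' : ∀ C : ℝ, ∀ᶠ n in U, C < δ n / s n := fun C =>
      (Ultrafilter.eventually_not.2 fun h => hc ⟨C, h⟩).mono fun n hn => not_le.1 hn
    have htop : Tendsto (fun n => δ n / s n) U atTop :=
      tendsto_atTop.2 fun C => (hc' C).mono fun n hn => hn.le
    have hδpos : ∀ᶠ n in U, 0 < δ n := (hc' 0).mono fun n hn => by
      have := mul_pos hn (hs n)
      rwa [div_mul_cancel₀ _ (hs n).ne'] at this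
    have hratio : Tendsto (fun n => s n / δ n) U (𝓝 0) :=
      htop.inv_tendsto_atTop.congr fun n => by simp
    have hnorm : ∀ᶠ n in U, ‖(δ n)⁻¹ • (A n - 1)‖ = 1 := hδpos.mono fun n hn => by
      rw [norm_smul, norm_inv, Real.norm_of_nonneg hn.le]
      exact inv_mul_cancel₀ hn.ne'
    obtain ⟨E, hE⟩ := hball (fun n => (δ n)⁻¹ • (A n - 1)) 1 (hnorm.mono fun n hn => hn.le)
    -- `E` projects to `0`, so `A n` times `exp (-δ n E)` stays inside `Γ (s n)`; this product
    -- is `1 + o (δ n)`, against the minimality of `δ n`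
    have hmem : ∀ τ : ℝ, NormedSpace.exp (τ • E) ∈ Γ 0 := fun τ => by
      simpa using hΓ.exp_mem_of_tangent U (Eventually.of_forall hA) hδpos hδ0 hE hratio τ
    have hexp : Tendsto (fun n => NormedSpace.exp ((-δ n) • E)) U (𝓝 1) := by
      have hcont : Continuous fun r : ℝ => NormedSpace.exp (r • E) :=
        NormedSpace.exp_continuous.comp (continuous_id.smul continuous_const)
      have := (hcont.tendsto 0).comp (show Tendsto (fun n => -δ n) U (𝓝 0) by simpa using hδ0.neg)
      rwa [zero_smul, NormedSpace.exp_zero] at this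
    have hderiv : Tendsto (fun n => (δ n)⁻¹ • (NormedSpace.exp ((-δ n) • E) - 1)) U (𝓝 (-E)) := by
      have h := hasDerivAt_exp_smul_const (𝕂 := ℝ) (-E) (0 : ℝ)
      rw [hasDerivAt_iff_tendsto_slope_zero] at h
      simp only [zero_add, zero_smul, NormedSpace.exp_zero, one_mul] at h
      refine (h.comp (tendsto_nhdsWithin_iff.2 ⟨hδ0, hδpos.mono fun i hi => hi.ne'⟩)).congr
        fun n => ?_
      simp
    have hlim : Tendsto (fun n => ‖(δ n)⁻¹ • (A n * NormedSpace.exp ((-δ n) • E) - 1)‖) U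
        (𝓝 0) := by
      have := ((hE.mul hexp).add hderiv).norm
      rw [mul_one, add_neg_cancel, norm_zero] at this
      refine this.congr fun n => ?_
      rw [smul_mul_assoc, ← smul_add]
      congr 2
      noncomm_ring
    have hge : ∀ᶠ n in U, 1 ≤ ‖(δ n)⁻¹ • (A n * NormedSpace.exp ((-δ n) • E) - 1)‖ := by
      filter_upwards [hnorm, hδpos] with n hn hpos
      rw [← hn, norm_smul, norm_smul]
      gcongr
      exact hAmin n _ (by simpa using hΓ.mul_mem (hA n) (hmem (-δ n)))
    exact absurd (ge_of_tendsto hlim hge) (by norm_num)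

end IsProperGradedGroup

end OneParameter

/-! ### Characteristic functions -/

/-- Two continuous functions on a preconnected space which have the same nowhere vanishing `q`-th
power and agree at one point are equal: their quotient takes values in the `q`-th roots of unity. -/
theorem eq_of_pow_eq_pow {W : Type*} [TopologicalSpace W] [PreconnectedSpace W] {f g : W → ℂ}
    (hf : Continuous f) (hg : Continuous g)
    (hg0 : ∀ u, g u ≠ 0) {o : W} (h0 : f o = g o) {q : ℕ} (hq : 0 < q)
    (h : ∀ u, f u ^ q = g u ^ q) : f = g := by
  have hfin : ({z : ℂ | z ^ q = 1}).Finite := by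
    have : {z : ℂ | z ^ q = 1} = (Polynomial.nthRootsFinset q (1 : ℂ) : Set ℂ) := by
      ext z; simp [Polynomial.mem_nthRootsFinset hq]
    rw [this]; exact Finset.finite_toSet _
  funext u
  have := isPreconnected_univ.constant_of_mapsTo hfin.isDiscrete
    (hf.div hg hg0).continuousOn (fun v _ => by
      simp [div_pow, h v, hg0 v]) (Set.mem_univ u) (Set.mem_univ o)
  rw [Pi.div_apply, Pi.div_apply, h0, div_self (hg0 o)] at this
  exact (div_eq_one_iff_eq (hg0 u)).1 this

section CharFun

open scoped RealInnerProductSpace ComplexConjugate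

variable {V : Type*} [NormedAddCommGroup V] [InnerProductSpace ℝ V] [FiniteDimensional ℝ V]
  [MeasurableSpace V] [BorelSpace V]

theorem charFun_map_clm (μ : Measure V) (A : V →L[ℝ] V) (u : V) :
    charFun (μ.map A) u = charFun μ (A.adjoint u) := by
  rw [charFun_apply, charFun_apply, integral_map (by fun_prop) (by fun_prop)]
  simp_rw [ContinuousLinearMap.adjoint_inner_right]

/-- Characteristic functions of weakly convergent probability measures converge continuously,
that is, locally uniformly. -/
theorem tendsto_charFun_prod_nhds {ι : Type*} {l : Filter ι} {μ : ι → ProbabilityMeasure V}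
    {μ₀ : ProbabilityMeasure V} (h : Tendsto μ l (𝓝 μ₀)) (u : V) :
    Tendsto (fun p : ι × V => charFun (μ p.1 : Measure V) p.2) (l ×ˢ 𝓝 u)
      (𝓝 (charFun (μ₀ : Measure V) u)) := by
  -- `charFun μ v` is the integral of one bounded continuous function against `μ ⊗ δ_v`
  have h1 : Tendsto (fun p : ι × V => (μ p.1).prod (diracProba p.2)) (l ×ˢ 𝓝 u)
      (𝓝 (μ₀.prod (diracProba u))) := by
    have h2 : Tendsto (fun p : ι × V => (μ p.1, diracProba p.2)) (l ×ˢ 𝓝 u)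
        (𝓝 (μ₀, diracProba u)) :=
      (h.comp tendsto_fst).prodMk_nhds ((continuous_diracProba.tendsto u).comp tendsto_snd)
    exact (ProbabilityMeasure.continuous_prod.tendsto (μ₀, diracProba u)).comp h2
  let f : BoundedContinuousFunction (V × V) ℂ := BoundedContinuousFunction.ofNormedAddCommGroup
    (fun p => Complex.exp (⟪p.1, p.2⟫ * Complex.I)) (by fun_prop) 1
    (fun p => (Complex.norm_exp_ofReal_mul_I _).le)
  have key : ∀ (ν : ProbabilityMeasure V) (v : V),
      ∫ p, f p ∂(ν.prod (diracProba v) : Measure (V × V)) = charFun (ν : Measure V) v := by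
    intro ν v
    have hf : Integrable f ((ν : Measure V).prod (Measure.dirac v)) := f.integrable _
    rw [charFun_apply]
    change ∫ p, f p ∂((ν : Measure V).prod (Measure.dirac v)) = _
    rw [integral_prod _ hf]
    simp [f]
  have := (ProbabilityMeasure.tendsto_iff_forall_integral_rclike_tendsto ℂ).1 h1 f
  simpa only [key] using this

theorem one_sub_norm_charFun_sq_le (μ : Measure V) [IsProbabilityMeasure μ] (u : V) :
    1 - ‖charFun μ ((2 : ℝ) • u)‖ ^ 2 ≤ 4 * (1 - ‖charFun μ u‖ ^ 2) := by
  -- `‖charFun μ‖²` is the characteristic function of the symmetrization of `μ`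
  have : IsProbabilityMeasure (μ.map fun x => -x) :=
    Measure.isProbabilityMeasure_map (by fun_prop)
  set σ : Measure V := μ ∗ (μ.map fun x => -x)
  have hσ : ∀ v, ‖charFun μ v‖ ^ 2 = ∫ z, Real.cos ⟪z, v⟫ ∂σ := by
    intro v
    have h1 : charFun (μ.map fun x => -x) v = conj (charFun μ v) := by
      rw [← charFun_neg, charFun_apply, charFun_apply, integral_map (by fun_prop) (by fun_prop)]
      simp
    have h2 : charFun σ v = ((‖charFun μ v‖ ^ 2 : ℝ) : ℂ) := by
      rw [charFun_conv, h1, RCLike.mul_conj]; simp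
    have h3 : (charFun σ v).re = ∫ z, Real.cos ⟪z, v⟫ ∂σ := by
      have hi : Integrable (fun z => Complex.exp (⟪z, v⟫ * Complex.I)) σ :=
        (integrable_const (1 : ℝ)).mono (by fun_prop) (by simp)
      rw [charFun_apply, ← RCLike.re_eq_complex_re, ← integral_re hi]
      simp [Complex.exp_ofReal_mul_I_re]
    rw [← h3, h2, Complex.ofReal_re]
  have hint : ∀ v : V, Integrable (fun z => Real.cos ⟪z, v⟫) σ := fun v =>
    (integrable_const (1 : ℝ)).mono (by fun_prop) (by simp [Real.abs_cos_le_one])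
  have h1 : ∀ v : V, 1 - ‖charFun μ v‖ ^ 2 = ∫ z, (1 - Real.cos ⟪z, v⟫) ∂σ := by
    intro v
    rw [integral_sub (integrable_const _) (hint v), hσ]
    simp
  rw [h1, h1, ← integral_const_mul]
  refine integral_mono ((integrable_const _).sub (hint _))
    (((integrable_const _).sub (hint _)).const_mul _) fun z => ?_
  simp only [inner_smul_right, Real.cos_two_mul]
  have := Real.cos_le_one ⟪z, u⟫
  have := Real.neg_one_le_cos ⟪z, u⟫
  nlinarith

/-- A nowhere vanishing characteristic function of a symmetric law is positive. -/
theorem charFun_eq_norm_of_even {μ : Measure V} [IsProbabilityMeasure μ]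
    (heven : μ.map (fun x => -x) = μ) (h0 : ∀ u, charFun μ u ≠ 0) (u : V) :
    charFun μ u = (‖charFun μ u‖ : ℂ) := by
  have hreal : ∀ v, conj (charFun μ v) = charFun μ v := by
    intro v
    rw [← charFun_neg]
    conv_rhs => rw [← heven]
    rw [charFun_apply, charFun_apply, integral_map (by fun_prop) (by fun_prop)]
    simp
  have hcont : Continuous (charFun μ) := continuous_charFun
  refine congrFun (eq_of_pow_eq_pow (g := fun v => (‖charFun μ v‖ : ℂ)) hcont (by fun_prop)
    (fun v => by simpa using h0 v) (o := 0) (by simp) two_pos fun v => ?_) u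
  -- a real number and its modulus have the same square
  rw [sq, ← Complex.ofReal_pow]
  nth_rewrite 2 [← hreal v]
  rw [RCLike.mul_conj]; simp

/-- The characteristic function of a law with a density tends to `0` at infinity by the
Riemann–Lebesgue lemma, so its modulus is not identically `1` on any line. -/
theorem exists_norm_charFun_smul_ne_one {f : V → ℝ} (hf : ∀ x, 0 ≤ f x) (hfi : Integrable f)
    {v : V} (hv : v ≠ 0) :
    ∃ s : ℝ, ‖charFun (volume.withDensity fun x => ENNReal.ofReal (f x)) (s • v)‖ ≠ 1 := by
  by_contra! hcon
  have h1 : ∀ u : V, charFun (volume.withDensity fun x => ENNReal.ofReal (f x)) u =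
      ∫ x, Real.fourierChar (-⟪x, -((2 * Real.pi)⁻¹ • u)⟫) • (f x : ℂ) := by
    intro u
    rw [charFun_apply, integral_withDensity_eq_integral_toReal_smul₀
      hfi.aestronglyMeasurable.aemeasurable.ennreal_ofReal (by simp)]
    refine integral_congr_ae (Eventually.of_forall fun x => ?_)
    simp only [ENNReal.toReal_ofReal (hf x), Circle.smul_def, Real.fourierChar_apply,
      inner_neg_right, neg_neg, inner_smul_right, Complex.real_smul, smul_eq_mul]
    rw [mul_comm]
    congr 3
    push_cast
    field_simp
  have h2 := (tendsto_integral_exp_inner_smul_cocompact (fun x => (f x : ℂ))).norm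
  have h3 : Tendsto (fun s : ℝ => -((2 * Real.pi)⁻¹ • (s • v))) atTop (cocompact V) := by
    rw [← Metric.cobounded_eq_cocompact, ← tendsto_norm_atTop_iff_cobounded]
    simp only [norm_neg, norm_smul]
    refine Tendsto.const_mul_atTop (by simp [Real.pi_ne_zero]) ?_
    exact tendsto_norm_atTop_atTop.atTop_mul_const (norm_pos_iff.2 hv)
  have h4 := h2.comp h3
  refine zero_ne_one (tendsto_nhds_unique (by simpa using h4) (tendsto_const_nhds.congr fun s => ?_))
  rw [← hcon s, h1]
  simp

end CharFun

/-! ### Limits of powers do not vanish -/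

section Nonvanishing

variable {V : Type*} [NormedAddCommGroup V] [NormedSpace ℝ V]

theorem ne_zero_of_forall_two_smul {a : V → ℝ} (ha : Continuous a) (h0 : a 0 ≠ 0)
    (h2 : ∀ u, a u ≠ 0 → a ((2 : ℝ) • u) ≠ 0) (u : V) : a u ≠ 0 := by
  have h1 : Tendsto (fun j : ℕ => ((1 / 2 : ℝ) ^ j) • u) atTop (𝓝 0) := by
    simpa using (tendsto_pow_atTop_nhds_zero_of_lt_one (by norm_num : (0 : ℝ) ≤ 1 / 2)
      (by norm_num)).smul_const u
  obtain ⟨j, hj⟩ := (((ha.tendsto 0).comp h1).eventually_ne h0).exists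
  have h3 : ∀ i : ℕ, a ((2 : ℝ) ^ i • ((1 / 2 : ℝ) ^ j) • u) ≠ 0 := by
    intro i
    induction i with
    | zero => simpa using hj
    | succ i ih => rw [pow_succ', mul_smul]; exact h2 _ ih
  have := h3 j
  rwa [smul_smul, ← mul_pow, mul_one_div_cancel two_ne_zero, one_pow, one_smul] at this

/-- If `x n ^ k n` stays away from `0`, then `1 - (x n)²` is of order `1 / k n`, so `y n ^ k n`
stays away from `0` as soon as `1 - (y n)²` is at most a multiple of `1 - (x n)²`. -/
theorem ne_zero_of_one_sub_sq_le {x y : ℕ → ℝ} {k : ℕ → ℕ} (hk : Tendsto k atTop atTop)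
    (hx0 : ∀ n, 0 ≤ x n) (hxy : ∀ n, 1 - y n ^ 2 ≤ 4 * (1 - x n ^ 2)) {p q : ℝ} (hp : 0 < p)
    (hx : Tendsto (fun n => x n ^ k n) atTop (𝓝 p))
    (hy : Tendsto (fun n => y n ^ k n) atTop (𝓝 q)) : q ≠ 0 := by
  -- eventually `c ≤ (x n ^ k n)²`, so `1 - (x n)² ≤ K / k n`
  set c : ℝ := p ^ 2 / 2
  have hc : 0 < c := by positivity
  set K : ℝ := -Real.log c
  have hxc : ∀ᶠ n in atTop, c ≤ (x n ^ k n) ^ 2 :=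
    (hx.pow 2).eventually (le_mem_nhds (half_lt_self (by positivity)))
  have hbern : Tendsto (fun n => (1 + (-(4 * K)) / (k n : ℝ)) ^ k n) atTop
      (𝓝 (Real.exp (-(4 * K)))) := (Real.tendsto_one_add_div_pow_exp _).comp hk
  have hbase : ∀ᶠ n in atTop, 0 ≤ 1 + (-(4 * K)) / (k n : ℝ) := by
    have h1 : Tendsto (fun n => 1 + (-(4 * K)) / (k n : ℝ)) atTop (𝓝 (1 + 0)) :=
      ((tendsto_const_div_atTop_nhds_zero_nat _).comp hk).const_add 1
    exact h1.eventually (le_mem_nhds (by norm_num))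
  have hle : ∀ᶠ n in atTop, (1 + (-(4 * K)) / (k n : ℝ)) ^ k n ≤ (y n ^ k n) ^ 2 := by
    filter_upwards [hxc, hbase, hk.eventually_gt_atTop 0] with n hn hb hkn
    have hkn' : (0 : ℝ) < k n := by exact_mod_cast hkn
    have hxn : 0 < x n ^ 2 := by
      rcases (hx0 n).eq_or_lt with h | h
      · rw [← h, zero_pow hkn.ne'] at hn
        norm_num at hn; linarith
      · positivity
    have h1 : 1 - x n ^ 2 ≤ K / k n := by
      have h2 := Real.log_le_log hc hn
      rw [← pow_mul, mul_comm (k n) 2, pow_mul, Real.log_pow] at h2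
      have h3 := Real.log_le_sub_one_of_pos hxn
      rw [le_div_iff₀ hkn']
      nlinarith
    rw [← pow_mul, mul_comm (k n) 2, pow_mul]
    refine pow_le_pow_left₀ hb ?_ _
    have := hxy n
    have h4 : -(4 * K) / (k n : ℝ) = -(4 * (K / k n)) := by ring
    rw [h4]; linarith
  rintro rfl
  have := le_of_tendsto_of_tendsto hbern (hy.pow 2) hle
  norm_num at this
  exact absurd this (not_le.2 (Real.exp_pos _))

/-- A continuous limit of powers `f (T n u) ^ k n` vanishes nowhere, if `1 - f²` grows at most
fourfold when its argument is doubled: the set where the limit does not vanish is a neighbourhood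
of the origin that is stable under doubling. -/
theorem ne_zero_of_tendsto_pow {f : V → ℝ} (hf0 : ∀ u, 0 ≤ f u)
    (hf2 : ∀ u, 1 - f ((2 : ℝ) • u) ^ 2 ≤ 4 * (1 - f u ^ 2)) {T : ℕ → V →L[ℝ] V}
    {k : ℕ → ℕ} (hk : Tendsto k atTop atTop) {a : V → ℝ} (ha : Continuous a) (ha1 : a 0 = 1)
    (ha0 : ∀ u, 0 ≤ a u)
    (h : ∀ v, Tendsto (fun p : ℕ × V => f (T p.1 p.2) ^ k p.1) (atTop ×ˢ 𝓝 v) (𝓝 (a v)))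
    (u : V) : a u ≠ 0 := by
  have h' : ∀ v, Tendsto (fun n => f (T n v) ^ k n) atTop (𝓝 (a v)) := fun v =>
    (h v).comp (tendsto_id.prodMk tendsto_const_nhds)
  refine ne_zero_of_forall_two_smul ha (by simp [ha1]) (fun u hu => ?_) u
  refine ne_zero_of_one_sub_sq_le hk (fun n => hf0 _) (fun n => ?_) ((ha0 u).lt_of_ne' hu)
    (h' u) (h' _)
  rw [map_smul]
  exact hf2 _

end Nonvanishing

/-! ### Convergence of types -/

section Types

variable {V : Type*} [NormedAddCommGroup V] [NormedSpace ℝ V]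

theorem tendsto_clm_apply {ι : Type*} {l : Filter ι} {C : ι → V →L[ℝ] V} {C₀ : V →L[ℝ] V}
    (h : Tendsto C l (𝓝 C₀)) (v : V) : Tendsto (fun i => C i v) l (𝓝 (C₀ v)) :=
  ((ContinuousLinearMap.apply ℝ V v).continuous.tendsto C₀).comp h

variable [FiniteDimensional ℝ V]

/-- Convergence of types: if `G i → a` continuously, `a` is not identically `1` on any line, and
the functions `G i ∘ C i` tend to `1` at the origin uniformly in `i`, then the operators `C i`
are bounded, hence convergent along the ultrafilter. Otherwise a limit `D` of `C i / ‖C i‖` would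
satisfy `a ∘ D = 1`. -/
theorem exists_tendsto_of_tendsto_comp {ι : Type*} (U : Ultrafilter ι) {G : ι → V → ℝ}
    {a : V → ℝ} (hG : ∀ v, Tendsto (fun p : ι × V => G p.1 p.2) (U ×ˢ 𝓝 v) (𝓝 (a v)))
    (hfull : ∀ v, v ≠ 0 → ∃ s : ℝ, a (s • v) ≠ 1) {C : ι → V →L[ℝ] V}
    (hC : ∀ v : ι → V, Tendsto v U (𝓝 0) → Tendsto (fun i => G i (C i (v i))) U (𝓝 1)) :
    ∃ C₀, Tendsto C U (𝓝 C₀) := by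
  have : ProperSpace (V →L[ℝ] V) := FiniteDimensional.proper ℝ _
  have hball : ∀ (f : ι → V →L[ℝ] V) (R : ℝ), (∀ᶠ n in U, ‖f n‖ ≤ R) →
      ∃ E, Tendsto f U (𝓝 E) := by
    intro f R hf
    obtain ⟨E, -, hE⟩ := (isCompact_closedBall (0 : V →L[ℝ] V) R).ultrafilter_le_nhds' (U.map f)
      (show ∀ᶠ n in U, f n ∈ Metric.closedBall 0 R from hf.mono fun n hn => by simpa using hn)
    exact ⟨E, hE⟩
  by_cases hc : ∃ R : ℝ, ∀ᶠ i in U, ‖C i‖ ≤ R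
  · obtain ⟨R, hR⟩ := hc
    exact hball C R hR
  · exfalso
    have hc' : ∀ R : ℝ, ∀ᶠ i in U, R < ‖C i‖ := fun R =>
      (Ultrafilter.eventually_not.2 fun h => hc ⟨R, h⟩).mono fun n hn => not_le.1 hn
    have htop : Tendsto (fun i => ‖C i‖) U atTop :=
      tendsto_atTop.2 fun R => (hc' R).mono fun n hn => hn.le
    have hnorm : ∀ᶠ i in U, ‖‖C i‖⁻¹ • C i‖ = 1 := (hc' 0).mono fun i hi => by
      rw [norm_smul, norm_inv, norm_norm, inv_mul_cancel₀ hi.ne']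
    obtain ⟨D, hD⟩ := hball (fun i => ‖C i‖⁻¹ • C i) 1 (hnorm.mono fun i hi => hi.le)
    have hD1 : ‖D‖ = 1 := tendsto_nhds_unique hD.norm
      (tendsto_const_nhds.congr' (hnorm.mono fun i hi => hi.symm))
    have hD0 : D ≠ 0 := by rintro rfl; simp at hD1
    obtain ⟨v, hv⟩ : ∃ v, D v ≠ 0 := by
      by_contra! h; exact hD0 (ContinuousLinearMap.ext h)
    obtain ⟨s, hs⟩ := hfull _ hv
    have hDv : Tendsto (fun i => (‖C i‖⁻¹ • C i) (s • v)) U (𝓝 (s • D v)) := by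
      rw [← map_smul]
      exact tendsto_clm_apply hD _
    have h1 := (hG (s • D v)).comp (tendsto_id.prodMk hDv)
    have h2 := hC (fun i => ‖C i‖⁻¹ • (s • v)) (by
      simpa using htop.inv_tendsto_atTop.smul_const (s • v))
    refine hs (tendsto_nhds_unique h1 (h2.congr fun i => ?_))
    simp [smul_comm s]

/-- The operators `A` with `a ∘ A = a ^ (exp s)`. -/
def scalingOperators (a : V → ℝ) (s : ℝ) : Set (V →L[ℝ] V) :=
  {A | ∀ u, a (A u) = a u ^ Real.exp s}

/-- The scaling operators of a positive function which is not identically `1` on any line form a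
closed group that projects properly onto `ℝ`. -/
theorem isProperGradedGroup_scalingOperators {a : V → ℝ} (ha : Continuous a) (ha0 : ∀ u, 0 < a u)
    (h0 : a 0 = 1) (hfull : ∀ v, v ≠ 0 → ∃ s : ℝ, a (s • v) ≠ 1)
    (hne : ∀ s, (scalingOperators a s).Nonempty) :
    IsProperGradedGroup (scalingOperators a) where
  nonempty := hne
  mul_mem := by
    intro s s' A A' hA hA' u
    rw [mul_apply_eq_comp, hA, hA', ← Real.rpow_mul (ha0 u).le, Real.exp_add, mul_comm]
  exists_inv := by
    intro s A hA
    have hinj : Function.Injective A := by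
      refine (injective_iff_map_eq_zero A).2 fun v hv => ?_
      by_contra hv0
      obtain ⟨r, hr⟩ := hfull v hv0
      have h1 := hA (r • v)
      rw [map_smul, hv, smul_zero, h0] at h1
      have h2 : (a (r • v) ^ Real.exp s) ^ Real.exp (-s) = 1 := by rw [← h1, Real.one_rpow]
      rw [← Real.rpow_mul (ha0 _).le, ← Real.exp_add, add_neg_cancel, Real.exp_zero,
        Real.rpow_one] at h2
      exact hr h2
    let e := (LinearEquiv.ofInjectiveEndo (A : V →ₗ[ℝ] V) hinj).toContinuousLinearEquiv
    have he : ∀ u, A (e.symm u) = u := fun u => e.apply_symm_apply u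
    refine ⟨e.symm, fun u => ?_, ContinuousLinearMap.ext he⟩
    conv_rhs => rw [← he u]
    rw [hA, ← Real.rpow_mul (ha0 _).le, ← Real.exp_add, add_neg_cancel, Real.exp_zero,
      Real.rpow_one]
    rfl
  exists_lim := by
    intro U s A σ hA hs
    have hrpow : ∀ {v : ℕ → V} {u : V}, Tendsto v U (𝓝 u) →
        Tendsto (fun n => a (A n (v n))) U (𝓝 (a u ^ Real.exp σ)) := by
      intro v u hv
      have h1 := ((ha.tendsto u).comp hv).rpow ((Real.continuous_exp.tendsto σ).comp hs)
        (Or.inl (ha0 u).ne')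
      exact h1.congr' (hA.mono fun n hn => (hn (v n)).symm)
    obtain ⟨A₀, hA₀⟩ := exists_tendsto_of_tendsto_comp U (G := fun _ => a) (a := a) (C := A)
      (fun v => (ha.tendsto v).comp tendsto_snd) hfull
      (fun v hv => by simpa [h0] using hrpow hv)
    refine ⟨A₀, fun u => ?_, hA₀⟩
    exact tendsto_nhds_unique ((ha.tendsto _).comp (tendsto_clm_apply hA₀ _))
      (hrpow tendsto_const_nhds)

theorem exists_exp_mem_scalingOperators {a : V → ℝ} (ha : Continuous a) (ha0 : ∀ u, 0 < a u)
    (h0 : a 0 = 1) (hfull : ∀ v, v ≠ 0 → ∃ s : ℝ, a (s • v) ≠ 1)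
    (hne : ∀ s, (scalingOperators a s).Nonempty) :
    ∃ E : V →L[ℝ] V, ∀ s : ℝ, NormedSpace.exp (s • E) ∈ scalingOperators a s := by
  have hΓ := isProperGradedGroup_scalingOperators ha ha0 h0 hfull hne
  rcases subsingleton_or_nontrivial V with hV | hV
  · refine ⟨0, fun s => ?_⟩
    obtain ⟨A, hA⟩ := hne s
    rwa [Subsingleton.elim (NormedSpace.exp (s • (0 : V →L[ℝ] V))) A]
  · exact hΓ.exists_exp_mem

/-- The sequence `k` nearly realizes every ratio: `k (l n) / k n → t` for suitable `l n → ∞`. -/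
theorem exists_subseq_ratio {k : ℕ → ℕ} (hk : Tendsto k atTop atTop)
    (hk' : Tendsto (fun n => (k (n + 1) : ℝ) / (k n : ℝ)) atTop (𝓝 1)) {t : ℝ} (ht : 0 < t) :
    ∃ l : ℕ → ℕ, Tendsto l atTop atTop ∧
      Tendsto (fun n => (k (l n) : ℝ) / (k n : ℝ)) atTop (𝓝 t) := by
  have hkR : Tendsto (fun n => (k n : ℝ)) atTop atTop := tendsto_natCast_atTop_atTop.comp hk
  have hex : ∀ n, ∃ m, t * k n ≤ k m := fun n => (hkR.eventually_ge_atTop _).exists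
  classical
  -- `l n` is the first index at which `k` reaches `t * k n`
  set l : ℕ → ℕ := fun n => Nat.find (hex n)
  have hl : ∀ n, t * k n ≤ k (l n) := fun n => Nat.find_spec (hex n)
  have hlmin : ∀ n m, m < l n → (k m : ℝ) < t * k n := fun n m hm =>
    not_le.1 (Nat.find_min (hex n) hm)
  have hltop : Tendsto l atTop atTop := by
    refine tendsto_atTop.2 fun N => ?_
    have h1 : ∀ᶠ n in atTop, ∀ m ∈ Finset.range N, (k m : ℝ) < t * k n :=
      (Finset.eventually_all _).2 fun m _ => (hkR.const_mul_atTop ht).eventually_gt_atTop _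
    filter_upwards [h1] with n hn
    by_contra! hlt
    exact absurd (hl n) (not_le.2 (hn _ (Finset.mem_range.2 hlt)))
  refine ⟨l, hltop, ?_⟩
  have hpred : Tendsto (fun n => l n - 1) atTop atTop := (tendsto_sub_atTop_nat 1).comp hltop
  have hup : Tendsto (fun n => t * ((k (l n - 1 + 1) : ℝ) / k (l n - 1))) atTop (𝓝 t) := by
    simpa using (hk'.comp hpred).const_mul t
  refine tendsto_of_tendsto_of_tendsto_of_le_of_le' tendsto_const_nhds hup ?_ ?_
  · filter_upwards [hkR.eventually_gt_atTop 0] with n hn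
    rw [le_div_iff₀ hn]
    exact hl n
  · filter_upwards [hkR.eventually_gt_atTop 0, (hkR.comp hpred).eventually_gt_atTop 0,
      hltop.eventually_ge_atTop 1] with n hn hp hl1
    simp only [Function.comp_apply] at hp
    rw [Nat.sub_add_cancel hl1, div_le_iff₀ hn, mul_comm t, mul_assoc, div_mul_eq_mul_div,
      le_div_iff₀ hp]
    have := (hlmin n (l n - 1) (by omega)).le
    gcongr

/-- Let `f ∘ T n` to the power `k n` converge continuously to `a`. Comparing `T n` with `T (l n)`,
where `k (l n) / k n → t`, shows that `a ^ t` is of the same type as `a`. -/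
theorem scalingOperators_nonempty {f : V → ℝ} (hf0 : ∀ u, 0 ≤ f u) (hf1 : f 0 = 1)
    {T : ℕ → V →L[ℝ] V}
    {k : ℕ → ℕ} (hk : Tendsto k atTop atTop)
    (hk' : Tendsto (fun n => (k (n + 1) : ℝ) / (k n : ℝ)) atTop (𝓝 1)) {a : V → ℝ}
    (ha0 : ∀ u, 0 < a u) (hfull : ∀ v, v ≠ 0 → ∃ s : ℝ, a (s • v) ≠ 1)
    (h : ∀ v, Tendsto (fun p : ℕ × V => f (T p.1 p.2) ^ k p.1) (atTop ×ˢ 𝓝 v) (𝓝 (a v)))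
    (s : ℝ) : (scalingOperators a s).Nonempty := by
  have : ProperSpace V := FiniteDimensional.proper ℝ V
  have h0 : a 0 = 1 := by
    refine tendsto_nhds_unique ((h 0).comp (tendsto_id.prodMk tendsto_const_nhds)) ?_
    simp [Function.comp_def, hf1]
  obtain ⟨l, hl, hlk⟩ := exists_subseq_ratio hk hk' (Real.exp_pos s)
  set U : Ultrafilter ℕ := hyperfilter ℕ
  have hU : (U : Filter ℕ) ≤ atTop := Nat.hyperfilter_le_atTop
  have hlU : Tendsto l U atTop := hl.mono_left hU
  have hG : ∀ v, Tendsto (fun p : ℕ × V => f (T (l p.1) p.2) ^ k (l p.1)) (U ×ˢ 𝓝 v)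
      (𝓝 (a v)) := fun v => (h v).comp (hlU.prodMap tendsto_id)
  -- otherwise unit vectors in the kernels accumulate at some `u₀`, and `a = 1` on the line of `u₀`
  have hinj : ∀ᶠ n in U, Function.Injective (T (l n)) := by
    by_contra hcon
    have hcon' : ∀ᶠ n in U, ∃ u : V, ‖u‖ = 1 ∧ T (l n) u = 0 := by
      refine (Ultrafilter.eventually_not.2 hcon).mono fun n hn => ?_
      rw [injective_iff_map_eq_zero] at hn
      push Not at hn
      obtain ⟨u, hu, hu0⟩ := hn
      refine ⟨‖u‖⁻¹ • u, ?_, by simp [hu]⟩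
      rw [norm_smul, norm_inv, norm_norm, inv_mul_cancel₀ (norm_ne_zero_iff.2 hu0)]
    have hchoice : ∃ u : ℕ → V, ∀ᶠ n in U, ‖u n‖ = 1 ∧ T (l n) (u n) = 0 := by
      refine ⟨fun n => Classical.epsilon fun u => ‖u‖ = 1 ∧ T (l n) u = 0, ?_⟩
      exact hcon'.mono fun n hn => Classical.epsilon_spec hn
    obtain ⟨u, hu⟩ := hchoice
    obtain ⟨u₀, -, hu₀⟩ := (isCompact_closedBall (0 : V) 1).ultrafilter_le_nhds' (U.map u)
      (show ∀ᶠ n in U, u n ∈ Metric.closedBall 0 1 from hu.mono fun n hn => by simp [hn.1])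
    have hu₀' : Tendsto u U (𝓝 u₀) := hu₀
    have hu₀1 : ‖u₀‖ = 1 := tendsto_nhds_unique hu₀'.norm
      (tendsto_const_nhds.congr' (hu.mono fun i hi => hi.1.symm))
    obtain ⟨r, hr⟩ := hfull u₀ (by rintro rfl; simp at hu₀1)
    refine hr (tendsto_nhds_unique ((hG (r • u₀)).comp
      (tendsto_id.prodMk (hu₀'.const_smul r))) (tendsto_const_nhds.congr' ?_))
    filter_upwards [hu] with n hn
    simp [hn.2, hf1]
  -- `C n = (T (l n))⁻¹ T n`
  have hchoice : ∃ C : ℕ → V →L[ℝ] V, ∀ᶠ n in U, ∀ u, T (l n) (C n u) = T n u := by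
    refine ⟨fun n => Classical.epsilon fun C => ∀ u, T (l n) (C u) = T n u, ?_⟩
    refine hinj.mono fun n hn => Classical.epsilon_spec
      (p := fun C : V →L[ℝ] V => ∀ u, T (l n) (C u) = T n u) ?_
    let e := (LinearEquiv.ofInjectiveEndo (T (l n) : V →ₗ[ℝ] V) hn).toContinuousLinearEquiv
    exact ⟨(e.symm : V →L[ℝ] V).comp (T n), fun u => e.apply_symm_apply (T n u)⟩
  obtain ⟨C, hC⟩ := hchoice
  have hconv : ∀ {v : ℕ → V} {u : V}, Tendsto v U (𝓝 u) →
      Tendsto (fun n => f (T (l n) (C n (v n))) ^ k (l n)) U (𝓝 (a u ^ Real.exp s)) := by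
    intro v u hv
    have h1 := (h u).comp ((tendsto_id.mono_left hU).prodMk hv)
    refine (h1.rpow (hlk.mono_left hU) (Or.inl (ha0 u).ne')).congr' ?_
    filter_upwards [hC, (hk.mono_left hU).eventually_gt_atTop 0] with n hn hkn
    have hkn' : (k n : ℝ) ≠ 0 := by positivity
    simp only [Function.comp_apply, id_eq]
    rw [hn, ← Real.rpow_natCast, ← Real.rpow_natCast, ← Real.rpow_mul (hf0 _),
      mul_div_cancel₀ _ hkn']
  obtain ⟨C₀, hC₀⟩ := exists_tendsto_of_tendsto_comp U
    (G := fun n u => f (T (l n) u) ^ k (l n)) hG hfull (C := C)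
    (fun v hv => by simpa [h0] using hconv hv)
  refine ⟨C₀, fun u => ?_⟩
  exact tendsto_nhds_unique ((hG (C₀ u)).comp
    (tendsto_id.prodMk (tendsto_clm_apply hC₀ _))) (hconv tendsto_const_nhds)

end Types

/-! ### Densities under linear changes of variables -/

section Densities

variable {V : Type*} [NormedAddCommGroup V] [InnerProductSpace ℝ V]
  [MeasurableSpace V] [BorelSpace V]

theorem measurableEmbedding_clequiv (e : V ≃L[ℝ] V) : MeasurableEmbedding e :=
  e.toHomeomorph.measurableEmbedding

variable [FiniteDimensional ℝ V]

theorem map_volume_clequiv (e : V ≃L[ℝ] V) :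
    (volume : Measure V).map e = ENNReal.ofReal |(e : V →L[ℝ] V).det|⁻¹ • volume := by
  have h : LinearMap.det ((e : V →L[ℝ] V) : V →ₗ[ℝ] V) ≠ 0 :=
    (LinearEquiv.isUnit_det' e.toLinearEquiv).ne_zero
  rw [← abs_inv]
  exact Measure.map_linearMap_addHaar_eq_smul_addHaar volume h

theorem integrable_comp_clequiv (e : V ≃L[ℝ] V) {F : Type*} [NormedAddCommGroup F] {f : V → F}
    (hf : Integrable f) : Integrable (fun x => f (e x)) := by
  have h : Integrable f ((volume : Measure V).map e) := by
    rw [map_volume_clequiv]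
    exact hf.smul_measure ENNReal.ofReal_ne_top
  exact (measurableEmbedding_clequiv e).integrable_map_iff.1 h

theorem integral_det_mul_comp_clequiv (e : V ≃L[ℝ] V) (he : 0 < (e : V →L[ℝ] V).det)
    (f : V → ℝ) : ∫ x, (e : V →L[ℝ] V).det * f (e x) = ∫ x, f x := by
  rw [integral_const_mul, ← (measurableEmbedding_clequiv e).integral_map (μ := volume) f]
  rw [map_volume_clequiv, integral_smul_measure, abs_of_pos he,
    ENNReal.toReal_ofReal (inv_nonneg.2 he.le), smul_eq_mul, ← mul_assoc, mul_inv_cancel₀ he.ne',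
    one_mul]

theorem withDensity_det_mul_comp_clequiv (e : V ≃L[ℝ] V) (he : 0 < (e : V →L[ℝ] V).det)
    (f : V → ℝ) :
    volume.withDensity (fun x => ENNReal.ofReal ((e : V →L[ℝ] V).det * f (e x))) =
      (volume.withDensity fun x => ENNReal.ofReal (f x)).map e.symm := by
  ext s hs
  have hpre : MeasurableSet (e.symm ⁻¹' s) := e.symm.continuous.measurable hs
  rw [Measure.map_apply e.symm.continuous.measurable hs, withDensity_apply _ hs,
    withDensity_apply _ hpre, ← lintegral_indicator hs, ← lintegral_indicator hpre]
  have h1 : ∀ x, s.indicator (fun x => ENNReal.ofReal ((e : V →L[ℝ] V).det * f (e x))) x =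
      ENNReal.ofReal (e : V →L[ℝ] V).det *
        (e.symm ⁻¹' s).indicator (fun x => ENNReal.ofReal (f x)) (e x) := by
    intro x
    by_cases hx : x ∈ s
    · have hx' : e x ∈ e.symm ⁻¹' s := by simpa using hx
      rw [Set.indicator_of_mem hx, Set.indicator_of_mem hx', ENNReal.ofReal_mul he.le]
    · have hx' : e x ∉ e.symm ⁻¹' s := by simpa using hx
      rw [Set.indicator_of_notMem hx, Set.indicator_of_notMem hx', mul_zero]
  simp_rw [h1]
  rw [lintegral_const_mul' _ _ ENNReal.ofReal_ne_top,
    ← (measurableEmbedding_clequiv e).lintegral_map (μ := volume)]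
  rw [map_volume_clequiv, lintegral_smul_measure, abs_of_pos he, smul_eq_mul, ← mul_assoc,
    ← ENNReal.ofReal_mul he.le, mul_inv_cancel₀ he.ne', ENNReal.ofReal_one, one_mul]

/-- The action `f ↦ det A · f ∘ A` on compactly supported continuous functions is continuous into
`L¹`. -/
theorem tendsto_integral_abs_sub_of_hasCompactSupport {ι : Type*} {l : Filter ι}
    [l.IsCountablyGenerated] {e : ι → V ≃L[ℝ] V} {e₀ : V ≃L[ℝ] V}
    (h : Tendsto (fun i => (e i : V →L[ℝ] V)) l (𝓝 e₀)) {f : V → ℝ} (hf : Continuous f)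
    (hfs : HasCompactSupport f) :
    Tendsto (fun i => ∫ x, |(e i : V →L[ℝ] V).det * f (e i x) - (e₀ : V →L[ℝ] V).det * f (e₀ x)|)
      l (𝓝 0) := by
  have hdet : Tendsto (fun i => (e i : V →L[ℝ] V).det) l (𝓝 (e₀ : V →L[ℝ] V).det) :=
    (ContinuousLinearMap.continuous_det.tendsto _).comp h
  obtain ⟨R, hR⟩ := hfs.isCompact.isBounded.subset_closedBall (0 : V)
  have hR' : ∀ y, R < ‖y‖ → f y = 0 := fun y hy => by
    refine image_eq_zero_of_notMem_tsupport fun hmem => ?_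
    have := hR hmem
    rw [mem_closedBall_zero_iff] at this
    linarith
  obtain ⟨M, hM⟩ := hf.bounded_above_of_compact_support hfs
  have hM0 : 0 ≤ M := (norm_nonneg _).trans (hM 0)
  set K : ℝ := ‖(e₀.symm : V →L[ℝ] V)‖ + 1
  have hK : 0 < K := by positivity
  have hKe : ∀ x, ‖x‖ ≤ K * ‖e₀ x‖ := fun x => by
    have := (e₀.symm : V →L[ℝ] V).le_opNorm (e₀ x)
    simp only [ContinuousLinearEquiv.coe_coe, ContinuousLinearEquiv.symm_apply_apply] at this
    refine this.trans ?_
    gcongr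
    simp [K]
  set D : ℝ := |(e₀ : V →L[ℝ] V).det| + 1
  -- for `e i` close to `e₀` all the functions are supported in one ball
  have hbound : ∀ᶠ i in l, ∀ x, ‖|(e i : V →L[ℝ] V).det * f (e i x) -
      (e₀ : V →L[ℝ] V).det * f (e₀ x)|‖ ≤
        (Metric.closedBall (0 : V) (2 * K * R)).indicator (fun _ => D * M + D * M) x := by
    have h1 : ∀ᶠ i in l, ‖(e i : V →L[ℝ] V) - e₀‖ ≤ 1 / (2 * K) := by
      have := (h.sub_const (e₀ : V →L[ℝ] V)).norm
      rw [sub_self, norm_zero] at this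
      exact this.eventually (ge_mem_nhds (by positivity))
    have h2 : ∀ᶠ i in l, |(e i : V →L[ℝ] V).det| ≤ D :=
      hdet.abs.eventually (ge_mem_nhds (by simp [D]))
    filter_upwards [h1, h2] with i hi hDi x
    rw [norm_abs_eq_norm]
    by_cases hx : x ∈ Metric.closedBall (0 : V) (2 * K * R)
    · rw [Set.indicator_of_mem hx]
      refine (norm_sub_le _ _).trans ?_
      rw [norm_mul, norm_mul]
      have hD0 : ‖(e₀ : V →L[ℝ] V).det‖ ≤ D := by simp [D]
      have hD : 0 ≤ D := (norm_nonneg _).trans hD0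
      exact add_le_add (mul_le_mul hDi (hM _) (norm_nonneg _) hD)
        (mul_le_mul hD0 (hM _) (norm_nonneg _) hD)
    · rw [Set.indicator_of_notMem hx]
      rw [mem_closedBall_zero_iff, not_le] at hx
      have hx0 : R < ‖e₀ x‖ := by
        have := hKe x
        by_contra! hle
        have : K * ‖e₀ x‖ ≤ K * R := by gcongr
        nlinarith [norm_nonneg (e₀ x), norm_nonneg x]
      have hxi : R < ‖e i x‖ := by
        have h3 := ((e i : V →L[ℝ] V) - e₀).le_opNorm x
        have h4 : ‖e₀ x‖ ≤ ‖e i x‖ + ‖((e i : V →L[ℝ] V) - e₀) x‖ := by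
          have := norm_sub_le (e i x) (((e i : V →L[ℝ] V) - e₀) x)
          simpa using this
        have h5 : ‖((e i : V →L[ℝ] V) - e₀) x‖ ≤ 1 / (2 * K) * ‖x‖ := h3.trans (by gcongr)
        have h6 : K * (1 / (2 * K) * ‖x‖) = ‖x‖ / 2 := by field_simp
        have h7 := hKe x
        have h8 : K * ‖e₀ x‖ ≤ K * ‖e i x‖ + ‖x‖ / 2 := by
          rw [← h6, ← mul_add]; gcongr; exact h4.trans (by gcongr)
        by_contra! hle
        have h9 : K * ‖e i x‖ ≤ K * R := by gcongr
        linarith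
      simp [hR' _ hx0, hR' _ hxi]
  have hlim := tendsto_integral_filter_of_dominated_convergence (μ := (volume : Measure V))
    (F := fun i x => |(e i : V →L[ℝ] V).det * f (e i x) - (e₀ : V →L[ℝ] V).det * f (e₀ x)|)
    (f := fun _ => 0) (l := l) _
    (Eventually.of_forall fun i => by
      have := (e i).continuous; have := e₀.continuous
      exact Continuous.aestronglyMeasurable (by fun_prop))
    (hbound.mono fun i hi => Eventually.of_forall hi)
    ((integrable_indicator_iff Metric.isClosed_closedBall.measurableSet).2
      (integrableOn_const (by exact (isCompact_closedBall _ _).measure_lt_top.ne)))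
    (Eventually.of_forall fun x => by
      have h1 := (hdet.mul ((hf.tendsto _).comp (tendsto_clm_apply h x))).sub_const
        ((e₀ : V →L[ℝ] V).det * f (e₀ x))
      simpa using h1.abs)
  simpa using hlim

/-- The action `f ↦ det A · f ∘ A` on integrable functions is continuous into `L¹`. -/
theorem tendsto_integral_abs_sub_comp_clequiv {ι : Type*} {l : Filter ι}
    [l.IsCountablyGenerated] {e : ι → V ≃L[ℝ] V} {e₀ : V ≃L[ℝ] V}
    (h : Tendsto (fun i => (e i : V →L[ℝ] V)) l (𝓝 e₀))
    (he : ∀ i, 0 < (e i : V →L[ℝ] V).det) (he₀ : 0 < (e₀ : V →L[ℝ] V).det)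
    {f : V → ℝ} (hf : Integrable f) :
    Tendsto (fun i => ∫ x, |(e i : V →L[ℝ] V).det * f (e i x) - (e₀ : V →L[ℝ] V).det * f (e₀ x)|)
      l (𝓝 0) := by
  refine Metric.tendsto_nhds.2 fun ε hε => ?_
  obtain ⟨g, hgs, hfg, hgc, hgi⟩ := hf.exists_hasCompactSupport_integral_sub_le
    (show 0 < ε / 3 by positivity)
  have hT : ∀ (e : V ≃L[ℝ] V) {f : V → ℝ}, Integrable f →
      Integrable fun x => (e : V →L[ℝ] V).det * f (e x) :=
    fun e f hf => (integrable_comp_clequiv e hf).const_mul _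
  have hiso : ∀ e : V ≃L[ℝ] V, 0 < (e : V →L[ℝ] V).det →
      ∫ x, |(e : V →L[ℝ] V).det * f (e x) - (e : V →L[ℝ] V).det * g (e x)| ≤ ε / 3 := by
    intro e he
    refine le_trans (le_of_eq ?_) hfg
    rw [← integral_det_mul_comp_clequiv e he fun x => ‖f x - g x‖]
    refine integral_congr_ae (Eventually.of_forall fun x => ?_)
    simp only
    rw [← mul_sub, abs_mul, abs_of_pos he, Real.norm_eq_abs]
  filter_upwards [(tendsto_integral_abs_sub_of_hasCompactSupport h hgc hgs).eventually
    (gt_mem_nhds (show 0 < ε / 3 by positivity))] with i hi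
  rw [dist_zero_right, Real.norm_of_nonneg (integral_nonneg fun x => abs_nonneg _)]
  have i1 := ((hT (e i) hf).sub (hT (e i) hgi)).abs
  have i2 := ((hT (e i) hgi).sub (hT e₀ hgi)).abs
  have i3 := ((hT e₀ hf).sub (hT e₀ hgi)).abs
  calc ∫ x, |(e i : V →L[ℝ] V).det * f (e i x) - (e₀ : V →L[ℝ] V).det * f (e₀ x)|
      ≤ ∫ x, ((|(e i : V →L[ℝ] V).det * f (e i x) - (e i : V →L[ℝ] V).det * g (e i x)| +
          |(e i : V →L[ℝ] V).det * g (e i x) - (e₀ : V →L[ℝ] V).det * g (e₀ x)|) +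
          |(e₀ : V →L[ℝ] V).det * f (e₀ x) - (e₀ : V →L[ℝ] V).det * g (e₀ x)|) := by
        refine integral_mono ((hT (e i) hf).sub (hT e₀ hf)).abs ((i1.add i2).add i3) fun x => ?_
        simp only
        rw [abs_sub_comm ((e₀ : V →L[ℝ] V).det * f (e₀ x))]
        exact (abs_sub_le _ ((e₀ : V →L[ℝ] V).det * g (e₀ x)) _).trans
          (by gcongr; exact abs_sub_le _ _ _)
    _ = _ := (integral_add (i1.add i2) i3).trans (congrArg (· + _) (integral_add i1 i2))
    _ < ε := by
        simp only [Pi.sub_apply]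
        linarith [hiso (e i) (he i), hiso e₀ he₀]

end Densities

/-! ### Auto-convolutions and characteristic functions -/

section ConvPower

variable {d : ℕ}

theorem IsProbDensity.isProbabilityMeasure {f : EuclideanSpace ℝ (Fin d) → ℝ}
    (hf : IsProbDensity f) : IsProbabilityMeasure (densityMeasure f) := by
  refine ⟨?_⟩
  rw [densityMeasure, withDensity_apply _ MeasurableSet.univ, Measure.restrict_univ,
    ← ofReal_integral_eq_lintegral_ofReal hf.integrable (Eventually.of_forall hf.nonneg),
    hf.integral_eq_one, ENNReal.ofReal_one]

theorem IsProbDensity.ae_eq_of_densityMeasure_eq {f g : EuclideanSpace ℝ (Fin d) → ℝ}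
    (hf : IsProbDensity f) (hg : IsProbDensity g) (h : densityMeasure f = densityMeasure g) :
    f =ᵐ[volume] g := by
  have h1 := (withDensity_eq_iff_of_sigmaFinite
    hf.integrable.aestronglyMeasurable.aemeasurable.ennreal_ofReal
    hg.integrable.aestronglyMeasurable.aemeasurable.ennreal_ofReal).1 h
  filter_upwards [h1] with x hx
  exact (ENNReal.ofReal_eq_ofReal_iff (hf.nonneg x) (hg.nonneg x)).1 hx

theorem isProbabilityMeasure_autoConv (μ : Measure (EuclideanSpace ℝ (Fin d)))
    [IsProbabilityMeasure μ] (n : ℕ) : IsProbabilityMeasure (autoConv μ n) := by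
  induction n with
  | zero => exact Measure.dirac.isProbabilityMeasure
  | succ n ih => rw [autoConv]; infer_instance

theorem charFun_autoConv (μ : Measure (EuclideanSpace ℝ (Fin d))) [IsProbabilityMeasure μ]
    (n : ℕ) (u : EuclideanSpace ℝ (Fin d)) : charFun (autoConv μ n) u = charFun μ u ^ n := by
  induction n with
  | zero => simp [autoConv, charFun_dirac]
  | succ n ih =>
    have := isProbabilityMeasure_autoConv μ n
    rw [autoConv, charFun_conv, ih, pow_succ]

theorem autoConv_eq_of_charFun {f g : EuclideanSpace ℝ (Fin d) → ℝ} (hf : IsProbDensity f)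
    (hg : IsProbDensity g) {n : ℕ}
    (h : ∀ u, charFun (densityMeasure f) u ^ n = charFun (densityMeasure g) u) :
    autoConv (densityMeasure f) n = densityMeasure g := by
  have := hf.isProbabilityMeasure
  have := hg.isProbabilityMeasure
  have := isProbabilityMeasure_autoConv (densityMeasure f) n
  exact Measure.ext_of_charFun (funext fun u => by rw [charFun_autoConv, h])

variable {f : EuclideanSpace ℝ (Fin d) → ℝ} {a : EuclideanSpace ℝ (Fin d) → ℝ}
  {g : ℝ → EuclideanSpace ℝ (Fin d) → ℝ}

theorem isRatConvPower_of_charFun (hf : IsProbDensity f) (ha0 : ∀ u, 0 < a u)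
    (hfa : ∀ u, charFun (densityMeasure f) u = (a u : ℂ))
    (hg : ∀ t, 0 < t → IsProbDensity (g t))
    (hga : ∀ t, 0 < t → ∀ u, charFun (densityMeasure (g t)) u = ((a u ^ t : ℝ) : ℂ))
    {r : ℚ} (hr : 0 < r) : IsRatConvPower f r (g r) := by
  have hr' : (0 : ℝ) < r := by exact_mod_cast hr
  have hden : (0 : ℝ) < r.den := by exact_mod_cast r.den_pos
  have hq : (0 : ℝ) < 1 / r.den := by positivity
  have hnum : 0 < r.num := Rat.num_pos.2 hr
  have hnat : ((r.num.toNat : ℤ)) = r.num := Int.toNat_of_nonneg hnum.le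
  have hrq : r = (r.num.toNat : ℚ) / (r.den : ℚ) := by
    rw [← Int.cast_natCast r.num.toNat, hnat, Rat.num_div_den]
  refine ⟨hg r hr', r.num.toNat, r.den, by omega, r.den_pos, hrq, g (1 / r.den), hg _ hq, ?_, ?_⟩
  · refine autoConv_eq_of_charFun (hg _ hq) hf fun u => ?_
    rw [hga _ hq, hfa, ← Complex.ofReal_pow, ← Real.rpow_mul_natCast (ha0 u).le,
      one_div_mul_cancel hden.ne', Real.rpow_one]
  · refine autoConv_eq_of_charFun (hg _ hq) (hg r hr') fun u => ?_
    have hrR : (r : ℝ) = 1 / r.den * (r.num.toNat : ℝ) := by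
      have := congrArg (Rat.cast (K := ℝ)) hrq
      rw [Rat.cast_div, Rat.cast_natCast, Rat.cast_natCast] at this
      rw [one_div_mul_eq_div, ← this]
    rw [hga _ hq, hga _ hr', ← Complex.ofReal_pow, ← Real.rpow_mul_natCast (ha0 u).le, ← hrR]

/-- Convolution roots of a law with positive characteristic function are unique, so that its
rational auto-convolutions are determined by their characteristic functions. -/
theorem IsRatConvPower.ae_eq (hf : IsProbDensity f) (ha0 : ∀ u, 0 < a u)
    (hfa : ∀ u, charFun (densityMeasure f) u = (a u : ℂ))
    (hg : ∀ t, 0 < t → IsProbDensity (g t))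
    (hga : ∀ t, 0 < t → ∀ u, charFun (densityMeasure (g t)) u = ((a u ^ t : ℝ) : ℂ))
    {r : ℚ} (hr : 0 < r) {h : EuclideanSpace ℝ (Fin d) → ℝ} (hh : IsRatConvPower f r h) :
    h =ᵐ[volume] g r := by
  have hr' : (0 : ℝ) < r := by exact_mod_cast hr
  obtain ⟨hh, p, q, hp, hq, hrpq, w, hw, hwf, hwh⟩ := hh
  have hq' : (0 : ℝ) < q := by exact_mod_cast hq
  have hq1 : (0 : ℝ) < 1 / q := by positivity
  have := hf.isProbabilityMeasure
  have := hw.isProbabilityMeasure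
  have := hh.isProbabilityMeasure
  have := (hg r hr').isProbabilityMeasure
  have := (hg _ hq1).isProbabilityMeasure
  have hroot : charFun (densityMeasure w) = charFun (densityMeasure (g (1 / q))) := by
    refine eq_of_pow_eq_pow continuous_charFun continuous_charFun (fun u => ?_) (o := 0)
      (by rw [charFun_zero, charFun_zero, probReal_univ, probReal_univ]) hq fun u => ?_
    · rw [hga _ hq1]
      exact_mod_cast (Real.rpow_pos_of_pos (ha0 u) _).ne'
    · rw [← charFun_autoConv, hwf, hfa, hga _ hq1, ← Complex.ofReal_pow,
        ← Real.rpow_mul_natCast (ha0 u).le, one_div_mul_cancel hq'.ne', Real.rpow_one]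
  refine hh.ae_eq_of_densityMeasure_eq (hg r hr') (Measure.ext_of_charFun (funext fun u => ?_))
  have hrR : (r : ℝ) = 1 / q * (p : ℝ) := by
    have := congrArg (Rat.cast (K := ℝ)) hrpq
    rw [Rat.cast_div, Rat.cast_natCast, Rat.cast_natCast] at this
    rw [one_div_mul_eq_div, ← this]
  rw [← hwh, charFun_autoConv, hroot, hga _ hq1, hga _ hr', ← Complex.ofReal_pow,
    ← Real.rpow_mul_natCast (ha0 u).le, ← hrR]

theorem isConvPower_of_charFun (hf : IsProbDensity f) (ha0 : ∀ u, 0 < a u)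
    (hfa : ∀ u, charFun (densityMeasure f) u = (a u : ℂ))
    (hg : ∀ t, 0 < t → IsProbDensity (g t))
    (hga : ∀ t, 0 < t → ∀ u, charFun (densityMeasure (g t)) u = ((a u ^ t : ℝ) : ℂ))
    (hgc : ∀ t, 0 < t → Tendsto (fun s => ∫ x, |g s x - g t x|) (𝓝 t) (𝓝 0))
    {t : ℝ} (ht : 0 < t) : IsConvPower f t (g t) where
  isProbDensity := hg t ht
  exists_rat r hr := ⟨_, isRatConvPower_of_charFun hf ha0 hfa hg hga hr⟩
  tendsto r h hr hrt hh := by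
    refine ((hgc t ht).comp hrt).congr fun n => integral_congr_ae ?_
    filter_upwards [IsRatConvPower.ae_eq hf ha0 hfa hg hga (hr n) (hh n)] with x hx
    rw [hx]

theorem IsConvPower.ae_eq {g₁ g₂ : EuclideanSpace ℝ (Fin d) → ℝ} {t : ℝ} (ht : 0 < t)
    (h₁ : IsConvPower f t g₁) (h₂ : IsConvPower f t g₂) : g₁ =ᵐ[volume] g₂ := by
  obtain ⟨r, hr, hrt⟩ : ∃ r : ℕ → ℚ, (∀ n, 0 < r n) ∧
      Tendsto (fun n => (r n : ℝ)) atTop (𝓝 t) := by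
    have h : ∀ n : ℕ, ∃ r : ℚ, t < r ∧ (r : ℝ) < t + 1 / ((n : ℝ) + 1) := fun n =>
      exists_rat_btwn (lt_add_of_pos_right t (by positivity))
    choose r hr1 hr2 using h
    refine ⟨r, fun n => by exact_mod_cast ht.trans (hr1 n), ?_⟩
    refine tendsto_of_tendsto_of_tendsto_of_le_of_le tendsto_const_nhds ?_
      (fun n => (hr1 n).le) (fun n => (hr2 n).le)
    simpa using tendsto_one_div_add_atTop_nhds_zero_nat.const_add t
  choose h hh using fun n => h₁.exists_rat (r n) (hr n)
  have hlim := (h₁.tendsto r h hr hrt hh).add (h₂.tendsto r h hr hrt hh)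
  have hi := (h₁.isProbDensity.integrable.sub h₂.isProbDensity.integrable).abs
  have hle : ∫ x, |g₁ x - g₂ x| ≤ 0 := by
    rw [add_zero] at hlim
    refine ge_of_tendsto hlim (Eventually.of_forall fun n => ?_)
    have i1 := ((hh n).1.integrable.sub h₁.isProbDensity.integrable).abs
    have i2 := ((hh n).1.integrable.sub h₂.isProbDensity.integrable).abs
    refine le_trans (integral_mono hi (i1.add i2) fun x => ?_) (integral_add i1 i2).le
    simp only [Pi.add_apply, Pi.sub_apply]
    rw [abs_sub_comm (h n x) (g₁ x)]
    exact abs_sub_le _ _ _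
  have h0 : (fun x => |g₁ x - g₂ x|) =ᵐ[volume] 0 :=
    (integral_eq_zero_iff_of_nonneg (fun x => abs_nonneg _) hi).1
      (le_antisymm hle (integral_nonneg fun x => abs_nonneg _))
  filter_upwards [h0] with x hx
  exact sub_eq_zero.1 (abs_eq_zero.1 hx)

end ConvPower

/-! ### The scaled densities -/

section Scaled

variable {d : ℕ}

theorem toEuclideanCLM_exp (A : Matrix (Fin d) (Fin d) ℝ) :
    Matrix.toEuclideanCLM (𝕜 := ℝ) (NormedSpace.exp A) =
      NormedSpace.exp (Matrix.toEuclideanCLM (𝕜 := ℝ) A) := by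
  open scoped Matrix.Norms.Operator in
  let : NormedAlgebra ℚ (Matrix (Fin d) (Fin d) ℝ) := .restrictScalars ℚ ℝ _
  exact NormedSpace.map_exp (Matrix.toEuclideanCLM (n := Fin d) (𝕜 := ℝ))
    (LinearMap.continuous_of_finiteDimensional
      (Matrix.toEuclideanCLM (n := Fin d) (𝕜 := ℝ)).toAlgEquiv.toLinearMap) A

theorem rpowMatrix_mul_rpowMatrix_neg (t : ℝ) (E : Matrix (Fin d) (Fin d) ℝ) :
    rpowMatrix t E * rpowMatrix t (-E) = 1 := by
  rw [rpowMatrix, rpowMatrix, ← Matrix.exp_add_of_commute _ _ (by simp), smul_neg,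
    add_neg_cancel, NormedSpace.exp_zero]

theorem det_rpowMatrix_pos (t : ℝ) (E : Matrix (Fin d) (Fin d) ℝ) :
    0 < (rpowMatrix t E).det := by
  -- the exponential is a square, so its determinant is nonnegative
  have h : rpowMatrix t E = NormedSpace.exp ((Real.log t / 2) • E) ^ 2 := by
    rw [← Matrix.exp_nsmul, rpowMatrix, ← Nat.cast_smul_eq_nsmul ℝ, smul_smul]
    congr 2
    push_cast; ring
  have h0 : (rpowMatrix t E).det ≠ 0 := fun h0 => by
    have h1 := congrArg Matrix.det (rpowMatrix_mul_rpowMatrix_neg t E)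
    rw [Matrix.det_mul, h0, zero_mul, Matrix.det_one] at h1
    exact zero_ne_one h1
  refine lt_of_le_of_ne ?_ h0.symm
  rw [h, Matrix.det_pow]
  exact sq_nonneg _

/-- The operator `t^{-E}` as an automorphism of `ℝ^d`, with inverse `t^E`. -/
noncomputable def rpowEquiv (E : Matrix (Fin d) (Fin d) ℝ) (t : ℝ) :
    EuclideanSpace ℝ (Fin d) ≃L[ℝ] EuclideanSpace ℝ (Fin d) :=
  ContinuousLinearEquiv.equivOfInverse (Matrix.toEuclideanCLM (𝕜 := ℝ) (rpowMatrix t (-E)))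
    (Matrix.toEuclideanCLM (𝕜 := ℝ) (rpowMatrix t E))
    (fun x => by
      rw [← mul_apply_eq_comp, ← map_mul, rpowMatrix_mul_rpowMatrix_neg, map_one]; rfl)
    (fun x => by
      have h := rpowMatrix_mul_rpowMatrix_neg t (-E)
      rw [neg_neg] at h
      rw [← mul_apply_eq_comp, ← map_mul, h, map_one]; rfl)

theorem coe_rpowEquiv (E : Matrix (Fin d) (Fin d) ℝ) (t : ℝ) :
    (rpowEquiv E t : EuclideanSpace ℝ (Fin d) →L[ℝ] EuclideanSpace ℝ (Fin d)) =
      Matrix.toEuclideanCLM (𝕜 := ℝ) (rpowMatrix t (-E)) := rfl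

theorem coe_rpowEquiv_symm (E : Matrix (Fin d) (Fin d) ℝ) (t : ℝ) :
    ((rpowEquiv E t).symm : EuclideanSpace ℝ (Fin d) →L[ℝ] EuclideanSpace ℝ (Fin d)) =
      NormedSpace.exp (Real.log t • Matrix.toEuclideanCLM (𝕜 := ℝ) E) := by
  rw [← map_smul, ← toEuclideanCLM_exp]
  rfl

theorem det_rpowEquiv (E : Matrix (Fin d) (Fin d) ℝ) (t : ℝ) :
    (rpowEquiv E t : EuclideanSpace ℝ (Fin d) →L[ℝ] EuclideanSpace ℝ (Fin d)).det =
      (rpowMatrix t (-E)).det := by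
  rw [coe_rpowEquiv, ContinuousLinearMap.det, Matrix.coe_toEuclideanCLM_eq_toEuclideanLin,
    Matrix.toEuclideanLin_eq_toLin_orthonormal, LinearMap.det_toLin]

theorem det_rpowEquiv_pos (E : Matrix (Fin d) (Fin d) ℝ) (t : ℝ) :
    0 < (rpowEquiv E t : EuclideanSpace ℝ (Fin d) →L[ℝ] EuclideanSpace ℝ (Fin d)).det := by
  rw [det_rpowEquiv]; exact det_rpowMatrix_pos t _

theorem tendsto_rpowEquiv (E : Matrix (Fin d) (Fin d) ℝ) {t : ℝ} (ht : 0 < t) :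
    Tendsto (fun s => (rpowEquiv E s : EuclideanSpace ℝ (Fin d) →L[ℝ] EuclideanSpace ℝ (Fin d)))
      (𝓝 t) (𝓝 (rpowEquiv E t)) := by
  simp_rw [coe_rpowEquiv, rpowMatrix, toEuclideanCLM_exp, map_smul]
  let : NormedAlgebra ℚ (EuclideanSpace ℝ (Fin d) →L[ℝ] EuclideanSpace ℝ (Fin d)) :=
    .restrictScalars ℚ ℝ _
  exact (NormedSpace.exp_continuous.tendsto _).comp
    ((Real.continuousAt_log ht.ne').tendsto.smul_const _)

theorem scaledDensity_eq (E : Matrix (Fin d) (Fin d) ℝ) (t : ℝ)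
    (f : EuclideanSpace ℝ (Fin d) → ℝ) :
    scaledDensity E t f = fun x =>
      (rpowEquiv E t : EuclideanSpace ℝ (Fin d) →L[ℝ] EuclideanSpace ℝ (Fin d)).det *
        f (rpowEquiv E t x) := by
  rw [det_rpowEquiv]; rfl

theorem IsProbDensity.scaledDensity {f : EuclideanSpace ℝ (Fin d) → ℝ} (hf : IsProbDensity f)
    (E : Matrix (Fin d) (Fin d) ℝ) (t : ℝ) : IsProbDensity (scaledDensity E t f) where
  nonneg x := mul_nonneg (det_rpowMatrix_pos t _).le (hf.nonneg _)
  integrable := by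
    rw [scaledDensity_eq]
    exact (integrable_comp_clequiv _ hf.integrable).const_mul _
  integral_eq_one := by
    rw [scaledDensity_eq, integral_det_mul_comp_clequiv _ (det_rpowEquiv_pos E t),
      hf.integral_eq_one]

theorem charFun_scaledDensity (f : EuclideanSpace ℝ (Fin d) → ℝ) (E : Matrix (Fin d) (Fin d) ℝ)
    (t : ℝ) (u : EuclideanSpace ℝ (Fin d)) :
    charFun (densityMeasure (scaledDensity E t f)) u = charFun (densityMeasure f)
      (NormedSpace.exp (Real.log t • Matrix.toEuclideanCLM (𝕜 := ℝ) E.transpose) u) := by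
  rw [densityMeasure, scaledDensity_eq,
    withDensity_det_mul_comp_clequiv _ (det_rpowEquiv_pos E t)]
  change charFun ((densityMeasure f).map ((rpowEquiv E t).symm :
    EuclideanSpace ℝ (Fin d) →L[ℝ] EuclideanSpace ℝ (Fin d))) u = _
  rw [charFun_map_clm, coe_rpowEquiv_symm, ← map_smul, ← map_smul, ← toEuclideanCLM_exp,
    ← toEuclideanCLM_exp, ← Matrix.transpose_smul, Matrix.exp_transpose,
    ← ContinuousLinearMap.star_eq_adjoint, ← map_star, Matrix.star_eq_conjTranspose,
    Matrix.conjTranspose_eq_transpose_of_trivial]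

theorem Continuous.scaledDensity {f : EuclideanSpace ℝ (Fin d) → ℝ} (hf : Continuous f)
    (E : Matrix (Fin d) (Fin d) ℝ) (t : ℝ) : Continuous (scaledDensity E t f) :=
  continuous_const.mul (hf.comp (Matrix.toEuclideanCLM (𝕜 := ℝ) _).continuous)

end Scaled

/-! ### The limit law of normed sums -/

section Limit

variable {d : ℕ}

theorem map_neg_densityMeasure {f : EuclideanSpace ℝ (Fin d) → ℝ} (heven : ∀ x, f (-x) = f x) :
    (densityMeasure f).map (fun x => -x) = densityMeasure f := by
  ext s hs
  have hs' : MeasurableSet ((fun x : EuclideanSpace ℝ (Fin d) => -x) ⁻¹' s) :=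
    measurable_neg hs
  rw [Measure.map_apply measurable_neg hs, densityMeasure, withDensity_apply _ hs',
    withDensity_apply _ hs, ← lintegral_indicator hs', ← lintegral_indicator hs,
    ← lintegral_neg_eq_self]
  refine lintegral_congr fun x => ?_
  by_cases hx : x ∈ s
  · have hx' : -x ∈ (fun x : EuclideanSpace ℝ (Fin d) => -x) ⁻¹' s := by simpa using hx
    rw [Set.indicator_of_mem hx, Set.indicator_of_mem hx', heven]
  · have hx' : -x ∉ (fun x : EuclideanSpace ℝ (Fin d) => -x) ⁻¹' s := by simpa using hx
    rw [Set.indicator_of_notMem hx, Set.indicator_of_notMem hx']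

theorem norm_charFun_map_normed_sum {Ω : Type*} [MeasurableSpace Ω] {P : Measure Ω}
    [IsProbabilityMeasure P] {X : ℕ → Ω → EuclideanSpace ℝ (Fin d)} (hindep : iIndepFun X P)
    (hident : ∀ i, IdentDistrib (X i) (X 0) P P)
    (B : EuclideanSpace ℝ (Fin d) →L[ℝ] EuclideanSpace ℝ (Fin d)) (b : EuclideanSpace ℝ (Fin d))
    (k : ℕ) (u : EuclideanSpace ℝ (Fin d)) :
    ‖charFun (P.map fun ω => B (∑ i ∈ Finset.range k, X i ω) - b) u‖ =
      ‖charFun (P.map (X 0)) (B.adjoint u)‖ ^ k := by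
  have hX : ∀ i, AEMeasurable (X i) P := fun i => (hident i).aemeasurable_fst
  have hS : AEMeasurable (fun ω => ∑ i ∈ Finset.range k, X i ω) P :=
    Finset.aemeasurable_fun_sum _ fun i _ => hX i
  have h1 : (P.map fun ω => B (∑ i ∈ Finset.range k, X i ω) - b) =
      ((P.map fun ω => ∑ i ∈ Finset.range k, X i ω).map B).map (· + -b) := by
    rw [AEMeasurable.map_map_of_aemeasurable (by fun_prop) hS,
      AEMeasurable.map_map_of_aemeasurable (by fun_prop) (by fun_prop)]
    simp only [Function.comp_def, sub_eq_add_neg]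
  rw [h1, charFun_map_add_const, norm_mul, Complex.norm_exp_ofReal_mul_I, mul_one,
    charFun_map_clm, iIndepFun.charFun_map_fun_finsetSum_eq_prod (fun i _ => hX i)
      (hindep.restrict _), Finset.prod_apply, norm_prod]
  simp [fun i => (hident i).map_eq]

theorem tendsto_norm_charFun_pow {Ω Ω' : Type*} [MeasurableSpace Ω] [MeasurableSpace Ω']
    {P : Measure Ω} [IsProbabilityMeasure P] {P' : Measure Ω'} [IsProbabilityMeasure P']
    {X : ℕ → Ω → EuclideanSpace ℝ (Fin d)}
    (hindep : iIndepFun X P) (hident : ∀ i, IdentDistrib (X i) (X 0) P P)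
    {B : ℕ → EuclideanSpace ℝ (Fin d) →L[ℝ] EuclideanSpace ℝ (Fin d)}
    {b : ℕ → EuclideanSpace ℝ (Fin d)} {k : ℕ → ℕ} {Y : Ω' → EuclideanSpace ℝ (Fin d)}
    (hlim : TendstoInDistribution
      (fun n ω => B n (∑ i ∈ Finset.range (k n), X i ω) - b n) atTop Y (fun _ => P) P')
    {f : EuclideanSpace ℝ (Fin d) → ℝ} (hY : P'.map Y = densityMeasure f)
    (v : EuclideanSpace ℝ (Fin d)) :
    Tendsto (fun p : ℕ × EuclideanSpace ℝ (Fin d) =>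
      ‖charFun (P.map (X 0)) ((B p.1).adjoint p.2)‖ ^ k p.1) (atTop ×ˢ 𝓝 v)
      (𝓝 ‖charFun (densityMeasure f) v‖) := by
  rw [← hY]
  exact (tendsto_charFun_prod_nhds hlim.tendsto v).norm.congr fun _ =>
    norm_charFun_map_normed_sum hindep hident _ _ _ _

/-- If the powers `‖charFun μ (T n u)‖ ^ k n` converge continuously to the modulus of the
characteristic function of an even density, then that characteristic function is a positive
function `a` which satisfies the scaling relation `a (t ^ A u) = a u ^ t` for some operator `A`. -/
theorem exists_operator_scaling {μ : Measure (EuclideanSpace ℝ (Fin d))}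
    [IsProbabilityMeasure μ]
    {T : ℕ → EuclideanSpace ℝ (Fin d) →L[ℝ] EuclideanSpace ℝ (Fin d)}
    {k : ℕ → ℕ} (hk : Tendsto k atTop atTop)
    (hk' : Tendsto (fun n => (k (n + 1) : ℝ) / (k n : ℝ)) atTop (𝓝 1))
    {ϖ : EuclideanSpace ℝ (Fin d) → ℝ} (hϖ : IsProbDensity ϖ) (heven : ∀ x, ϖ (-x) = ϖ x)
    (hconv : ∀ v, Tendsto (fun p : ℕ × EuclideanSpace ℝ (Fin d) =>
      ‖charFun μ (T p.1 p.2)‖ ^ k p.1) (atTop ×ˢ 𝓝 v) (𝓝 ‖charFun (densityMeasure ϖ) v‖)) :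
    ∃ a : EuclideanSpace ℝ (Fin d) → ℝ, (∀ u, 0 < a u) ∧
      (∀ u, charFun (densityMeasure ϖ) u = (a u : ℂ)) ∧
      ∃ A : EuclideanSpace ℝ (Fin d) →L[ℝ] EuclideanSpace ℝ (Fin d), ∀ t : ℝ, 0 < t → ∀ u,
        a (NormedSpace.exp (Real.log t • A) u) = a u ^ t := by
  have := hϖ.isProbabilityMeasure
  have hacont : Continuous fun u => ‖charFun (densityMeasure ϖ) u‖ := continuous_charFun.norm
  have ha1 : ‖charFun (densityMeasure ϖ) 0‖ = 1 := by simp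
  have hane : ∀ u, ‖charFun (densityMeasure ϖ) u‖ ≠ 0 :=
    ne_zero_of_tendsto_pow (f := fun u => ‖charFun μ u‖) (T := T) (fun u => norm_nonneg _)
      (one_sub_norm_charFun_sq_le μ) hk hacont ha1 (fun u => norm_nonneg _) hconv
  have hapos : ∀ u, 0 < ‖charFun (densityMeasure ϖ) u‖ := fun u =>
    (norm_nonneg _).lt_of_ne' (hane u)
  have hfull : ∀ v, v ≠ 0 → ∃ s : ℝ, ‖charFun (densityMeasure ϖ) (s • v)‖ ≠ 1 := fun v hv =>
    exists_norm_charFun_smul_ne_one hϖ.nonneg hϖ.integrable hv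
  obtain ⟨A, hA⟩ := exists_exp_mem_scalingOperators hacont hapos ha1 hfull
    (scalingOperators_nonempty (f := fun u => ‖charFun μ u‖) (T := T) (fun u => norm_nonneg _)
      (by simp) hk hk' hapos hfull hconv)
  refine ⟨_, hapos, charFun_eq_norm_of_even (map_neg_densityMeasure heven)
    fun u => norm_ne_zero_iff.1 (hane u), A, fun t ht u => ?_⟩
  have := hA (Real.log t) u
  rwa [Real.exp_log ht] at this

end Limit

theorem mainTheorem8 {d : ℕ}
    {Ω Ω' : Type*} [MeasurableSpace Ω] [MeasurableSpace Ω']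
    (P : Measure Ω) [IsProbabilityMeasure P] (P' : Measure Ω') [IsProbabilityMeasure P']
    -- independent, identically distributed random vectors
    (X : ℕ → Ω → EuclideanSpace ℝ (Fin d))
    (hindep : iIndepFun X P) (hident : ∀ i, IdentDistrib (X i) (X 0) P P)
    -- norming operators, centring vectors and numbers of summands
    (B : ℕ → EuclideanSpace ℝ (Fin d) →L[ℝ] EuclideanSpace ℝ (Fin d))
    (b : ℕ → EuclideanSpace ℝ (Fin d))
    (k : ℕ → ℕ) (hk : Tendsto k atTop atTop)
    (hk' : Tendsto (fun n => (k (n + 1) : ℝ) / (k n : ℝ)) atTop (𝓝 1))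
    -- the limit, with an even density
    (Y : Ω' → EuclideanSpace ℝ (Fin d))
    (hlim : TendstoInDistribution
      (fun n ω => B n (∑ i ∈ Finset.range (k n), X i ω) - b n) atTop Y (fun _ => P) P')
    (ϖ : EuclideanSpace ℝ (Fin d) → ℝ) (hϖ : IsProbDensity ϖ)
    (hY : P'.map Y = densityMeasure ϖ)
    (heven : ∀ x, ϖ (-x) = ϖ x) :
    ∃ E : Matrix (Fin d) (Fin d) ℝ, ∀ t : ℝ, 0 < t →
      (∃ g, IsConvPower ϖ t g) ∧
      (∀ g, IsConvPower ϖ t g → ∀ᵐ x, g x = scaledDensity E t ϖ x) ∧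
      (Continuous ϖ →
        (∃ g, IsConvPower ϖ t g ∧ Continuous g) ∧
        ∀ g, IsConvPower ϖ t g → Continuous g → ∀ x, g x = scaledDensity E t ϖ x) := by
  have : IsProbabilityMeasure (P.map (X 0)) :=
    Measure.isProbabilityMeasure_map (hident 0).aemeasurable_fst
  obtain ⟨a, hapos, hϖa, A, hA⟩ := exists_operator_scaling hk hk' hϖ heven
    (μ := P.map (X 0)) (T := fun n => (B n).adjoint)
    (tendsto_norm_charFun_pow hindep hident hlim hY)
  -- characteristic functions are transformed by the adjoint operator, hence the transpose
  obtain ⟨M, hM⟩ : ∃ M, Matrix.toEuclideanCLM (𝕜 := ℝ) M = A :=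
    (Matrix.toEuclideanCLM (n := Fin d) (𝕜 := ℝ)).surjective A
  have hconv : ∀ t, 0 < t → IsConvPower ϖ t (scaledDensity M.transpose t ϖ) := fun t ht => by
    refine isConvPower_of_charFun (g := fun t => scaledDensity M.transpose t ϖ) hϖ hapos hϖa
      (fun s _ => hϖ.scaledDensity _ s) (fun s hs u => ?_) (fun s hs => ?_) ht
    · rw [charFun_scaledDensity, Matrix.transpose_transpose, hM, hϖa, hA s hs]
    · simp only [scaledDensity_eq]
      exact tendsto_integral_abs_sub_comp_clequiv (tendsto_rpowEquiv _ hs)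
        (fun i => det_rpowEquiv_pos _ i) (det_rpowEquiv_pos _ s) hϖ.integrable
  refine ⟨M.transpose, fun t ht => ⟨⟨_, hconv t ht⟩, fun g hg => hg.ae_eq ht (hconv t ht),
    fun hcont => ⟨⟨_, hconv t ht, hcont.scaledDensity _ t⟩, fun g hg hgc x => ?_⟩⟩⟩
  exact congrFun ((hgc.ae_eq_iff_eq volume (hcont.scaledDensity _ t)).1
    (hg.ae_eq ht (hconv t ht))) x
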